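/- Let $d\ge 1$ and $n\ge 0$ be integers. Let $Br_{d,n}$ (the framed Brauer monoid) be the monoid presented by generators $s_1,\dots,s_{n-1}$, $t_1,\dots,t_{n-1}$, $z_1,\dots,z_n$ subject to the following relations, where the indices run over all values for which the generators are defined: \begin{align*} & z_i^d=1,\qquad z_iz_j=z_jz_i;\\ & s_i^2=1,\qquad s_is_j=s_js_i\ \text{ if } |i-j|>1,\qquad s_is_js_i=s_js_is_j\ \text{ if } |i-j|=1;\\ & z_js_i=s_iz_{s_i(j)},\ \text{ where } s_i(j) \text{ is the image of } j \text{ under the transposition } (i,i+1);\\ & t_i^2=t_i,\qquad t_it_j=t_jt_i\ \text{ if } |i-j|>1,\qquad t_it_jt_i=t_i\ \text{ if } |i-j|=1;\\ & t_iz_i=t_iz_{i+1},\qquad z_it_i=z_{i+1}t_i,\qquad z_it_j=t_jz_i\ \text{ if } i\ne j,j+1,\qquad t_iz_i^kt_i=t_i\ \text{ for all } k\ge 0;\\ & t_is_i=s_it_i=t_i,\qquad t_is_j=s_jt_i\ \text{ if } |i-j|>1;\\ & s_it_jt_i=s_jt_i,\qquad t_it_js_i=t_is_j\ \text{ if } |i-j|=1.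 \end{align*} Then $Br_{d,n}$ is finite and has exactly $d^n\cdot(2n-1)!!$ elements (with the convention $(-1)!!=1$ for $n=0$). -/

import Mathlib

/-- The generators of the framed Brauer monoid on `n` strands: `s i`, `t i` with `n - 1` possible
indices and `z j` with `n` possible indices. Indices start at `0`, so `s i`, `t i`, `z j` are the
generators usually written `s_{i+1}`, `t_{i+1}`, `z_{j+1}`. -/
inductive FramedBrauerGen (n : ℕ) : Type
  | s (i : Fin (n - 1)) : FramedBrauerGen n
  | t (i : Fin (n - 1)) : FramedBrauerGen n
  | z (j : Fin n) : FramedBrauerGen n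

namespace FramedBrauer

variable {n : ℕ}

/-- The strand `i`, the first of the two strands on which `s i` and `t i` act. -/
def left (i : Fin (n - 1)) : Fin n := ⟨i, by omega⟩

/-- The strand `i + 1`, the second of the two strands on which `s i` and `t i` act. -/
def right (i : Fin (n - 1)) : Fin n := ⟨i + 1, by omega⟩

/-- `|i - j| > 1`. -/
def Far (i j : Fin (n - 1)) : Prop := (i : ℕ) + 1 < j ∨ (j : ℕ) + 1 < i

/-- `|i - j| = 1`. -/
def Near (i j : Fin (n - 1)) : Prop := (i : ℕ) + 1 = j ∨ (j : ℕ) + 1 = i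

/-- The one-letter word `s i`. -/
def s (i : Fin (n - 1)) : FreeMonoid (FramedBrauerGen n) := FreeMonoid.of (.s i)

/-- The one-letter word `t i`. -/
def t (i : Fin (n - 1)) : FreeMonoid (FramedBrauerGen n) := FreeMonoid.of (.t i)

/-- The one-letter word `z j`. -/
def z (j : Fin n) : FreeMonoid (FramedBrauerGen n) := FreeMonoid.of (.z j)

/-- The defining relations of the framed Brauer monoid `Br_{d,n}`. -/
inductive Rel (d n : ℕ) :
    FreeMonoid (FramedBrauerGen n) → FreeMonoid (FramedBrauerGen n) → Prop
  -- Framing generators: the presentation of `(ℤ/dℤ)^n`, written multiplicatively.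
  | z_pow (j : Fin n) : Rel d n (z j ^ d) 1
  | z_comm (i j : Fin n) : Rel d n (z i * z j) (z j * z i)
  -- Coxeter relations.
  | s_sq (i : Fin (n - 1)) : Rel d n (s i * s i) 1
  | s_comm (i j : Fin (n - 1)) (h : Far i j) : Rel d n (s i * s j) (s j * s i)
  | s_braid (i j : Fin (n - 1)) (h : Near i j) : Rel d n (s i * s j * s i) (s j * s i * s j)
  -- Wreath product relation; `Equiv.swap (left i) (right i)` is the transposition `s_i`.
  | z_s (i : Fin (n - 1)) (j : Fin n) :
      Rel d n (z j * s i) (s i * z (Equiv.swap (left i) (right i) j))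
  -- Jones relations.
  | t_idem (i : Fin (n - 1)) : Rel d n (t i * t i) (t i)
  | t_comm (i j : Fin (n - 1)) (h : Far i j) : Rel d n (t i * t j) (t j * t i)
  | t_t_t (i j : Fin (n - 1)) (h : Near i j) : Rel d n (t i * t j * t i) (t i)
  -- Mixed relations between the `t i` and the framing generators.
  | t_z (i : Fin (n - 1)) : Rel d n (t i * z (left i)) (t i * z (right i))
  | z_t (i : Fin (n - 1)) : Rel d n (z (left i) * t i) (z (right i) * t i)
  | z_t_comm (i : Fin n) (j : Fin (n - 1)) (hl : i ≠ left j) (hr : i ≠ right j) :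
      Rel d n (z i * t j) (t j * z i)
  | t_z_t (i : Fin (n - 1)) (k : ℕ) : Rel d n (t i * z (left i) ^ k * t i) (t i)
  -- Mixed relations between the `t i` and the `s i`.
  | t_s (i : Fin (n - 1)) : Rel d n (t i * s i) (t i)
  | s_t (i : Fin (n - 1)) : Rel d n (s i * t i) (t i)
  | t_s_comm (i j : Fin (n - 1)) (h : Far i j) : Rel d n (t i * s j) (s j * t i)
  | s_t_t (i j : Fin (n - 1)) (h : Near i j) : Rel d n (s i * t j * t i) (s j * t i)
  | t_t_s (i j : Fin (n - 1)) (h : Near i j) : Rel d n (t i * t j * s i) (t i * s j)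

end FramedBrauer

/-- The framed Brauer monoid `Br_{d,n}`: the monoid presented by the generators
`FramedBrauerGen n` and the relations `FramedBrauer.Rel d n`. -/
abbrev FramedBrauerMonoid (d n : ℕ) : Type := PresentedMonoid (FramedBrauer.Rel d n)

/-! The monoid is identified with the perfect matchings of `2n` points (`n` on top, `n` at the
bottom) whose edges carry labels in `ZMod d`. Removing the edge at a chosen point, which has `2n -
1` possible mates and `d` possible labels, shows by induction that there are `d ^ n * (2n - 1)‼` of
these (`card_diag`). The monoid acts on matchings through the top points: `s i` permutes two of
them, `z j` adds `1` to a label, and `t i` joins two of them, connects their former mates and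
forgets any closed loop. Evaluating this action at the identity matching is a bijection. Injectivity
rests on a normal form. The Coxeter relations give a homomorphism from the symmetric group
(`exists_permHom`), and conjugating the `t i` by it gives hooks `h a b` for all `a ≠ b`
(`exists_hook`). Two hooks with a common end reduce to one hook times a transposition
(`hook_mul_hook`), so every element is `z^α * T * z^β * π` with `T` a product of disjoint hooks
(`isNormal`). The matching of such a product determines the arcs of `T`, determines `π` up to a
permutation absorbed by `T` (`hooks_mul_permHom`), and determines `α` and `β` up to framings
absorbed by `T` (`zVec_mul_hooks_mul_zVec`). Hence equal matchings come from equal elements.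
Surjectivity is by induction on the number of top points matched to top points: one hook restores a
top edge and a bottom edge from two through edges. -/

namespace FramedBrauer

/-! ### The Coxeter presentation of the symmetric group -/

section CoxeterPerm

open Equiv

/-- The descending product `g N * g (N - 1) * ⋯` with `k` factors. -/
def descProd {K : Type*} [Monoid K] (g : ℕ → K) (N : ℕ) : ℕ → K
  | 0 => 1
  | k + 1 => descProd g N k * g (N - k)

variable {K : Type*} [Monoid K] {g : ℕ → K} {N : ℕ}

theorem descProd_mul_of_lt (hcomm : ∀ i j, i + 1 < j → j ≤ N → g i * g j = g j * g i)
    {k i : ℕ} (h : i + k < N) :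
    descProd g N k * g i = g i * descProd g N k := by
  induction k with
  | zero => simp [descProd]
  | succ k ih =>
    have h1 := hcomm i (N - k) (by omega) (by omega)
    rw [descProd, mul_assoc, ← h1, ← mul_assoc, ih (by omega), mul_assoc]

/-- Moving left, `g (i + 1)` meets `g (i + 1) * g i`. The braid relation turns it into `g i`, which
commutes with all remaining larger factors. -/
theorem descProd_mul_of_gt (hcomm : ∀ i j, i + 1 < j → j ≤ N → g i * g j = g j * g i)
    (hbraid : ∀ i, i + 1 ≤ N → g i * g (i + 1) * g i = g (i + 1) * g i * g (i + 1))
    {k i : ℕ} (hk : k ≤ N + 1) (hi : i + 1 ≤ N) (h : N + 1 ≤ i + k) :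
    descProd g N k * g (i + 1) = g i * descProd g N k := by
  induction k with
  | zero => omega
  | succ k ih =>
    by_cases hik : N + 1 ≤ i + k
    · have h1 := hcomm (N - k) (i + 1) (by omega) (by omega)
      rw [descProd, mul_assoc, h1, ← mul_assoc, ih (by omega) hik, mul_assoc]
    · obtain ⟨k, rfl⟩ : ∃ l, k = l + 1 := ⟨k - 1, by omega⟩
      obtain rfl : i = N - (k + 1) := by omega
      have e : N - k = N - (k + 1) + 1 := by omega
      rw [descProd, descProd, e, mul_assoc, mul_assoc, ← mul_assoc (g (N - (k + 1) + 1)),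
        ← hbraid _ hi, ← mul_assoc, ← mul_assoc, descProd_mul_of_lt hcomm (by omega)]
      simp only [mul_assoc]

/-- The descending products are representatives for the cosets of the subgroup generated by the
first `N` generators, as in the usual bound by `(N + 2)!` on the order of the Coxeter group. -/
theorem exists_mul_descProd_of_mem_closure
    (hsq : ∀ i, i ≤ N → g i * g i = 1)
    (hcomm : ∀ i j, i + 1 < j → j ≤ N → g i * g j = g j * g i)
    (hbraid : ∀ i, i + 1 ≤ N → g i * g (i + 1) * g i = g (i + 1) * g i * g (i + 1))
    {x : K} (hx : x ∈ Submonoid.closure {y | ∃ i < N + 1, g i = y}) :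
    ∃ y ∈ Submonoid.closure {y | ∃ i < N, g i = y}, ∃ k ≤ N + 1, x = y * descProd g N k := by
  induction hx using Submonoid.closure_induction_right with
  | one => exact ⟨1, one_mem _, 0, by omega, by simp [descProd]⟩
  | mul_right x _ z hz ih =>
    obtain ⟨i, hi, rfl⟩ := hz
    obtain ⟨y, hy, k, hk, rfl⟩ := ih
    -- The last factor of `descProd g N k` is `g (N - k + 1)`. According to its position, `g i`
    -- slides out to the left, lengthens the product, cancels the last factor, or slides out with
    -- its index lowered by one.
    rcases lt_trichotomy (i + k) N with h | h | h
    · refine ⟨y * g i, mul_mem hy (Submonoid.subset_closure ⟨i, by omega, rfl⟩), k, hk, ?_⟩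
      rw [mul_assoc, descProd_mul_of_lt hcomm h, mul_assoc]
    · refine ⟨y, hy, k + 1, by omega, ?_⟩
      rw [mul_assoc, descProd, show N - k = i by omega]
    · by_cases h' : i + k = N + 1
      · obtain ⟨k, rfl⟩ : ∃ l, k = l + 1 := ⟨k - 1, by omega⟩
        refine ⟨y, hy, k, by omega, ?_⟩
        rw [descProd, show N - k = i by omega, mul_assoc, mul_assoc, hsq i (by omega), mul_one]
      · obtain ⟨i, rfl⟩ : ∃ l, i = l + 1 := ⟨i - 1, by omega⟩
        refine ⟨y * g i, mul_mem hy (Submonoid.subset_closure ⟨i, by omega, rfl⟩), k, hk, ?_⟩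
        rw [mul_assoc, descProd_mul_of_gt hcomm hbraid hk (by omega) (by omega), mul_assoc]

theorem swap_succ_mul_comm {i j : ℕ} (h : i + 1 < j) :
    swap i (i + 1) * swap j (j + 1) = swap j (j + 1) * swap i (i + 1) := by
  ext x
  simp only [Perm.mul_apply, swap_apply_def]
  grind

theorem swap_succ_braid (i : ℕ) :
    swap i (i + 1) * swap (i + 1) (i + 1 + 1) * swap i (i + 1) =
      swap (i + 1) (i + 1 + 1) * swap i (i + 1) * swap (i + 1) (i + 1 + 1) := by
  ext x
  simp only [Perm.mul_apply, swap_apply_def]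
  grind

variable {M : Type*} [Monoid M]

/-- Pairing elements `s i` with the adjacent transpositions of `ℕ`. -/
def withSwap (s : ℕ → M) (i : ℕ) : M × Perm ℕ := (s i, swap i (i + 1))

theorem descProd_withSwap_snd (s : ℕ → M) {k : ℕ} (hk : k ≤ N + 1) :
    (descProd (withSwap s) N k).2 (N + 1 - k) = N + 1 := by
  induction k with
  | zero => simp [descProd]
  | succ k ih =>
    have e : N + 1 - (k + 1) = N - k := by omega
    rw [descProd, Prod.snd_mul, Perm.mul_apply, e, withSwap, swap_apply_left]
    rw [show N - k + 1 = N + 1 - k by omega, ih (by omega)]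

theorem apply_eq_self_of_mem_closure_withSwap (s : ℕ → M) {x : M × Perm ℕ}
    (hx : x ∈ Submonoid.closure {y | ∃ i < N, withSwap s i = y}) {k : ℕ} (hk : N < k) :
    x.2 k = k := by
  induction hx using Submonoid.closure_induction with
  | mem x hx =>
    obtain ⟨i, hi, rfl⟩ := hx
    exact swap_apply_of_ne_of_ne (by omega) (by omega)
  | one => rfl
  | mul x y _ _ hx hy => rw [Prod.snd_mul, Perm.mul_apply, hy, hx]

/-- Write the element as `y * descProd _ N k`. The permutation of the second factor sends `N + 1 -
k` to `N + 1`, and that of `y` fixes `N + 1`. If the total permutation is trivial then `k = 0`, so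
one generator fewer suffices. -/
theorem fst_eq_one_of_mem_closure_withSwap (s : ℕ → M)
    (hsq : ∀ i, i < N → s i * s i = 1)
    (hcomm : ∀ i j, i + 1 < j → j < N → s i * s j = s j * s i)
    (hbraid : ∀ i, i + 1 < N → s i * s (i + 1) * s i = s (i + 1) * s i * s (i + 1))
    {m : M} (hx : (m, (1 : Perm ℕ)) ∈ Submonoid.closure {y | ∃ i < N, withSwap s i = y}) :
    m = 1 := by
  induction N with
  | zero =>
    simp only [not_lt_zero, false_and, exists_false, Set.ofPred_false, Submonoid.closure_empty,
      Submonoid.mem_bot] at hx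
    exact congrArg Prod.fst hx
  | succ N ih =>
    obtain ⟨y, hy, k, hk, e⟩ := exists_mul_descProd_of_mem_closure
      (fun i hi => Prod.ext (hsq i (by omega)) (swap_mul_self _ _))
      (fun i j hij hj => Prod.ext (hcomm i j hij (by omega)) (swap_succ_mul_comm hij))
      (fun i hi => Prod.ext (hbraid i (by omega)) (swap_succ_braid i)) hx
    have h1 := congrArg (fun q => q.2 (N + 1 - k)) e
    simp only [Prod.snd_mul, Perm.mul_apply, Perm.one_apply, descProd_withSwap_snd s hk,
      apply_eq_self_of_mem_closure_withSwap s hy (Nat.lt_succ_self N)] at h1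
    obtain rfl : k = 0 := by omega
    rw [descProd, mul_one] at e
    exact ih (fun i hi => hsq i (by omega)) (fun i j hij hj => hcomm i j hij (by omega))
      (fun i hi => hbraid i (by omega)) (e ▸ hy)

theorem closure_swap_left_right (n : ℕ) :
    Submonoid.closure (Set.range fun i : Fin (n - 1) => swap (left i) (right i)) = ⊤ := by
  cases n with
  | zero => exact Subsingleton.elim _ _
  | succ n =>
    exact Perm.mclosure_swap_castSucc_succ n

/-- A family satisfying the Coxeter relations of type `A` defines a homomorphism on permutations. -/
theorem exists_permHom {n : ℕ} (s : Fin (n - 1) → M) (hsq : ∀ i, s i * s i = 1)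
    (hcomm : ∀ i j, Far i j → s i * s j = s j * s i)
    (hbraid : ∀ i j, Near i j → s i * s j * s i = s j * s i * s j) :
    ∃ φ : Perm (Fin n) →* M, ∀ i, φ (swap (left i) (right i)) = s i := by
  -- `R` will be the graph of the homomorphism; it remains to see that it is single-valued and
  -- total.
  let R : Submonoid (M × Perm (Fin n)) :=
    Submonoid.closure (Set.range fun i => (s i, swap (left i) (right i)))
  let s' : ℕ → M := fun i => if h : i < n - 1 then s ⟨i, h⟩ else 1
  have hs' : ∀ i (h : i < n - 1), s' i = s ⟨i, h⟩ := fun i h => dif_pos h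
  let E : M × Perm (Fin n) →* M × Perm ℕ :=
    MonoidHom.prodMap (MonoidHom.id M) (Perm.extendDomainHom Fin.equivSubtype)
  have hE : ∀ x ∈ R, E x ∈ Submonoid.closure {y | ∃ i < n - 1, withSwap s' i = y} := by
    intro x hx
    rw [← Submonoid.mem_comap]
    revert x
    change R ≤ _
    rw [Submonoid.closure_le]
    rintro _ ⟨i, rfl⟩
    refine Submonoid.subset_closure ⟨i, i.2, ?_⟩
    refine Prod.ext (hs' i i.2) ?_
    change swap (i : ℕ) (i + 1) = (swap (left i) (right i)).extendDomain Fin.equivSubtype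
    ext x
    by_cases hx : x < n
    · have h1 := Perm.extendDomain_apply_image (swap (left i) (right i)) Fin.equivSubtype ⟨x, hx⟩
      refine Eq.trans ?_ h1.symm
      simp only [swap_apply_def, left, right, Fin.ext_iff, Fin.equivSubtype]
      grind
    · refine Eq.trans ?_ (Perm.extendDomain_apply_not_subtype (swap (left i) (right i))
        Fin.equivSubtype (b := x) hx).symm
      exact swap_apply_of_ne_of_ne (by omega) (by omega)
  have hone : ∀ m : M, (m, (1 : Perm (Fin n))) ∈ R → m = 1 := by
    intro m hm
    have h1 := hE _ hm
    have e : E (m, 1) = (m, 1) := Prod.ext rfl (map_one (Perm.extendDomainHom Fin.equivSubtype))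
    rw [e] at h1
    refine fst_eq_one_of_mem_closure_withSwap s' ?_ ?_ ?_ h1
    · intro i hi
      rw [hs' i hi, hsq]
    · intro i j hij hj
      rw [hs' i (by omega), hs' j hj, hcomm _ _ (Or.inl hij)]
    · intro i hi
      rw [hs' i (by omega), hs' (i + 1) hi, hbraid _ _ (Or.inl rfl)]
  -- `M` is only a monoid, so the inverses needed to reduce uniqueness to the fibre over `1` are
  -- built inside `R`.
  have hinv : ∀ x ∈ R, ∃ m', m' * x.1 = 1 ∧ (m', x.2⁻¹) ∈ R := by
    intro x hx
    induction hx using Submonoid.closure_induction with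
    | mem x hx =>
      obtain ⟨i, rfl⟩ := hx
      exact ⟨s i, hsq i, Submonoid.subset_closure ⟨i, by simp⟩⟩
    | one => exact ⟨1, one_mul _, one_mem R⟩
    | mul x y _ _ hx hy =>
      obtain ⟨a, ha, ha'⟩ := hx
      obtain ⟨b, hb, hb'⟩ := hy
      refine ⟨b * a, ?_, ?_⟩
      · rw [Prod.fst_mul, mul_assoc, ← mul_assoc a, ha, one_mul, hb]
      · simpa using mul_mem hb' ha'
  have huniq : ∀ m m' π, (m, π) ∈ R → (m', π) ∈ R → m = m' := by
    intro m m' π h h'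
    obtain ⟨a, ha, ha'⟩ := hinv _ h
    obtain ⟨b, hb, hb'⟩ := hinv _ ha'
    have h1 : a * m' = 1 := hone _ (by simpa using mul_mem ha' h')
    simp only at ha hb
    have h2 : b = m := by
      rw [← mul_one b, ← ha, ← mul_assoc, hb, one_mul]
    have h3 : b = m' := by
      rw [← mul_one b, ← h1, ← mul_assoc, hb, one_mul]
    rw [← h2, h3]
  have hsurj : ∀ π : Perm (Fin n), ∃ m, (m, π) ∈ R := by
    intro π
    have : π ∈ Submonoid.closure (Set.range fun i : Fin (n - 1) => swap (left i) (right i)) := by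
      rw [closure_swap_left_right]; trivial
    induction this using Submonoid.closure_induction with
    | mem x hx =>
      obtain ⟨i, rfl⟩ := hx
      exact ⟨s i, Submonoid.subset_closure ⟨i, rfl⟩⟩
    | one => exact ⟨1, one_mem R⟩
    | mul x y _ _ hx hy =>
      obtain ⟨a, ha⟩ := hx
      obtain ⟨b, hb⟩ := hy
      exact ⟨a * b, mul_mem ha hb⟩
  choose f hf using hsurj
  refine ⟨⟨⟨f, huniq _ _ 1 (hf 1) (one_mem R)⟩, fun π ρ => ?_⟩, fun i => ?_⟩
  · exact huniq _ _ _ (hf _) (mul_mem (hf π) (hf ρ))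
  · exact huniq _ _ _ (hf _) (Submonoid.subset_closure ⟨i, rfl⟩)

end CoxeterPerm

/-! ### Permutations and framings in the presented monoid -/

section Presented

open Equiv PresentedMonoid

variable (d n : ℕ)

/-- The image of the generator `s i` in the framed Brauer monoid. -/
def genS (i : Fin (n - 1)) : FramedBrauerMonoid d n := of (Rel d n) (.s i)

/-- The image of the generator `t i` in the framed Brauer monoid. -/
def genT (i : Fin (n - 1)) : FramedBrauerMonoid d n := of (Rel d n) (.t i)

/-- The image of the generator `z j` in the framed Brauer monoid. -/
def genZ (j : Fin n) : FramedBrauerMonoid d n := of (Rel d n) (.z j)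

theorem exists_presented_permHom :
    ∃ φ : Perm (Fin n) →* FramedBrauerMonoid d n, ∀ i, φ (swap (left i) (right i)) = genS d n i :=
  exists_permHom (genS d n) (fun i => mk_eq_mk_of_rel (.s_sq i))
    (fun i j h => mk_eq_mk_of_rel (.s_comm i j h)) (fun i j h => mk_eq_mk_of_rel (.s_braid i j h))

/-- The homomorphism from permutations to the framed Brauer monoid. -/
noncomputable def permHom : Perm (Fin n) →* FramedBrauerMonoid d n :=
  (exists_presented_permHom d n).choose

variable {d n}

theorem permHom_swap (i : Fin (n - 1)) :
    permHom d n (swap (left i) (right i)) = genS d n i :=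
  (exists_presented_permHom d n).choose_spec i

theorem genZ_pow (j : Fin n) : genZ d n j ^ d = 1 := mk_eq_mk_of_rel (.z_pow j)

theorem genZ_commute (i j : Fin n) : Commute (genZ d n i) (genZ d n j) :=
  mk_eq_mk_of_rel (.z_comm i j)

theorem genZ_mul_genS (i : Fin (n - 1)) (j : Fin n) :
    genZ d n j * genS d n i = genS d n i * genZ d n (swap (left i) (right i) j) :=
  mk_eq_mk_of_rel (.z_s i j)

theorem genT_mul_genT_of_far {i j : Fin (n - 1)} (h : Far i j) :
    genT d n i * genT d n j = genT d n j * genT d n i := mk_eq_mk_of_rel (.t_comm i j h)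

theorem genT_mul_genT_mul_genT {i j : Fin (n - 1)} (h : Near i j) :
    genT d n i * genT d n j * genT d n i = genT d n i := mk_eq_mk_of_rel (.t_t_t i j h)

theorem genT_mul_genZ (i : Fin (n - 1)) :
    genT d n i * genZ d n (left i) = genT d n i * genZ d n (right i) :=
  mk_eq_mk_of_rel (.t_z i)

theorem genZ_mul_genT (i : Fin (n - 1)) :
    genZ d n (left i) * genT d n i = genZ d n (right i) * genT d n i :=
  mk_eq_mk_of_rel (.z_t i)

theorem genZ_commute_genT {i : Fin n} {j : Fin (n - 1)} (hl : i ≠ left j) (hr : i ≠ right j) :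
    Commute (genZ d n i) (genT d n j) := mk_eq_mk_of_rel (.z_t_comm i j hl hr)

theorem genT_mul_genZ_pow_mul_genT (i : Fin (n - 1)) (k : ℕ) :
    genT d n i * genZ d n (left i) ^ k * genT d n i = genT d n i := by
  have := mk_eq_mk_of_rel (Rel.t_z_t (d := d) i k)
  rwa [map_mul, map_mul, map_pow] at this

theorem genT_mul_genS (i : Fin (n - 1)) : genT d n i * genS d n i = genT d n i :=
  mk_eq_mk_of_rel (.t_s i)

theorem genS_mul_genT (i : Fin (n - 1)) : genS d n i * genT d n i = genT d n i :=
  mk_eq_mk_of_rel (.s_t i)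

theorem genT_mul_genS_of_far {i j : Fin (n - 1)} (h : Far i j) :
    genT d n i * genS d n j = genS d n j * genT d n i := mk_eq_mk_of_rel (.t_s_comm i j h)

theorem genS_mul_genT_mul_genT {i j : Fin (n - 1)} (h : Near i j) :
    genS d n i * genT d n j * genT d n i = genS d n j * genT d n i :=
  mk_eq_mk_of_rel (.s_t_t i j h)

theorem genT_mul_genT_mul_genS {i j : Fin (n - 1)} (h : Near i j) :
    genT d n i * genT d n j * genS d n i = genT d n i * genS d n j :=
  mk_eq_mk_of_rel (.t_t_s i j h)

theorem genS_mul_self (i : Fin (n - 1)) : genS d n i * genS d n i = 1 :=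
  mk_eq_mk_of_rel (.s_sq i)

/-- Replace `t j` by `t j * t i * t j`, then apply one mixed relation on each side. This is what
makes neighbouring `t i` conjugate under permutations. -/
theorem genS_mul_genT_mul_genS {i j : Fin (n - 1)} (h : Near i j) :
    genS d n i * genT d n j * genS d n i = genS d n j * genT d n i * genS d n j := by
  have hji : Near j i := h.symm
  calc genS d n i * genT d n j * genS d n i
      = genS d n i * (genT d n j * genT d n i * genT d n j) * genS d n i := by
        rw [genT_mul_genT_mul_genT hji]
    _ = genS d n i * genT d n j * genT d n i * (genT d n j * genS d n i) := by
        simp only [mul_assoc]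
    _ = genS d n j * genT d n i * (genT d n j * genS d n i) := by rw [genS_mul_genT_mul_genT h]
    _ = genS d n j * (genT d n i * genT d n j * genS d n i) := by simp only [mul_assoc]
    _ = genS d n j * genT d n i * genS d n j := by rw [genT_mul_genT_mul_genS h]; simp only [mul_assoc]

theorem permHom_mul_genZ (π : Perm (Fin n)) (j : Fin n) :
    permHom d n π * genZ d n j = genZ d n (π j) * permHom d n π := by
  have : π ∈ Submonoid.closure (Set.range fun i : Fin (n - 1) => swap (left i) (right i)) := by
    rw [closure_swap_left_right]; trivial
  induction this using Submonoid.closure_induction generalizing j with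
  | mem x hx =>
    obtain ⟨i, rfl⟩ := hx
    rw [permHom_swap, genZ_mul_genS, swap_apply_self]
  | one => simp
  | mul x y _ _ hx hy =>
    rw [map_mul, mul_assoc, hy, ← mul_assoc, hx, mul_assoc, Perm.mul_apply]

/-- Single vectors are tested only at the values of `α` itself, so that hypotheses such as `α a = 0`
stay usable in the induction. -/
theorem zVec_induction {P : (Fin n → ZMod d) → Prop} (α : Fin n → ZMod d) (h0 : P 0)
    (hadd : ∀ α β, P α → P β → P (α + β)) (hs : ∀ j, P (Pi.single j (α j))) : P α := by
  rw [← Finset.univ_sum_single α]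
  exact Finset.sum_induction _ P hadd h0 fun j _ => hs j

section Framing

variable [NeZero d]

theorem genZ_pow_val_add (j : Fin n) (k l : ZMod d) :
    genZ d n j ^ (k + l).val = genZ d n j ^ k.val * genZ d n j ^ l.val := by
  rw [ZMod.val_add, ← pow_add]
  exact (pow_eq_pow_mod _ (genZ_pow j)).symm

/-- The powers of `z j`, with exponents modulo `d`. -/
def zPowHom (j : Fin n) : Multiplicative (ZMod d) →* FramedBrauerMonoid d n where
  toFun k := genZ d n j ^ (Multiplicative.toAdd k).val
  map_one' := by simp
  map_mul' k l := genZ_pow_val_add j _ _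

/-- The product of the `z j ^ α j`. -/
def zVec (α : Fin n → ZMod d) : FramedBrauerMonoid d n :=
  MonoidHom.noncommPiCoprod (zPowHom (d := d) (n := n))
    (fun i j _ _ _ => (genZ_commute i j).pow_pow _ _) (fun i => Multiplicative.ofAdd (α i))

theorem zVec_add (α β : Fin n → ZMod d) : zVec (α + β) = zVec α * zVec β :=
  map_mul (MonoidHom.noncommPiCoprod (zPowHom (d := d) (n := n)) _)
    (fun i => Multiplicative.ofAdd (α i)) (fun i => Multiplicative.ofAdd (β i))

theorem zVec_zero : zVec (0 : Fin n → ZMod d) = 1 :=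
  map_one (MonoidHom.noncommPiCoprod (zPowHom (d := d) (n := n)) _)

theorem zVec_single (j : Fin n) (k : ZMod d) : zVec (Pi.single j k) = genZ d n j ^ k.val := by
  refine Eq.trans ?_ (MonoidHom.noncommPiCoprod_mulSingle (ϕ := zPowHom (d := d) (n := n))
    (hcomm := fun i j _ _ _ => (genZ_commute i j).pow_pow _ _) j (Multiplicative.ofAdd k))
  rw [zVec]
  congr 1

theorem zVec_commute (α β : Fin n → ZMod d) : Commute (zVec α) (zVec β) := by
  rw [Commute, SemiconjBy, ← zVec_add, ← zVec_add, add_comm]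

theorem permHom_mul_zVec (π : Perm (Fin n)) (α : Fin n → ZMod d) :
    permHom d n π * zVec α = zVec (α ∘ π.symm) * permHom d n π := by
  refine zVec_induction
    (P := fun α => permHom d n π * zVec α = zVec (α ∘ π.symm) * permHom d n π) α ?_ (fun α β hα hβ => ?_) (fun j => ?_)
  · rw [Pi.zero_comp, zVec_zero, mul_one, one_mul]
  · rw [zVec_add, ← mul_assoc, hα, mul_assoc, hβ, ← mul_assoc, ← zVec_add]; rfl
  · have : (Pi.single j (α j) : Fin n → ZMod d) ∘ π.symm = Pi.single (π j) (α j) := by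
      ext i
      simp [Pi.single_apply, symm_apply_eq]
    rw [this, zVec_single, zVec_single]
    exact SemiconjBy.pow_right (permHom_mul_genZ π j) _

end Framing

end Presented

/-! ### Hooks on arbitrary pairs of strands -/

section Hooks

open Equiv

/-- Multiple transitivity of the symmetric group: any identity between hooks can be conjugated to
standard positions, where it is a defining relation. -/
theorem exists_perm_map_eq {V : Type*} [Finite V] (l l' : List V) (h : l.Nodup) (h' : l'.Nodup)
    (hl : l.length = l'.length) : ∃ π : Perm V, l.map π = l' := by
  obtain ⟨π, hπ⟩ := Perm.exists_extending_pair (fun i => l.get i)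
    (fun i : Fin l.length => l'.get (i.cast hl)) (List.nodup_iff_injective_get.1 h)
    ((List.nodup_iff_injective_get.1 h').comp (Fin.cast_injective hl))
  refine ⟨π, List.ext_get (by simpa using hl) fun i h1 h2 => ?_⟩
  simpa using hπ ⟨i, by simpa using h1⟩

variable {d n : ℕ}

theorem commute_swap_of_le (h : 1 < n) {a b : ℕ} (ha : 2 ≤ a) (hab : a < b) (hb : b < n) :
    Commute (permHom d n (swap ⟨a, by omega⟩ ⟨b, hb⟩)) (genT d n ⟨0, by omega⟩) := by
  induction b, hab using Nat.le_induction with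
  | base =>
    have h1 := permHom_swap (d := d) (⟨a, by omega⟩ : Fin (n - 1))
    simp only [left, right] at h1
    simp only [Nat.succ_eq_add_one, h1]
    exact (genT_mul_genS_of_far (Or.inl (by simp; omega))).symm
  | succ b hab ih =>
    have h1 := permHom_swap (d := d) (⟨b, by omega⟩ : Fin (n - 1))
    simp only [left, right] at h1
    have h2 : Commute (permHom d n (swap ⟨b, by omega⟩ ⟨b + 1, hb⟩)) (genT d n ⟨0, by omega⟩) := by
      rw [h1]
      exact (genT_mul_genS_of_far (Or.inl (by simp; omega))).symm
    have h3 : swap (⟨a, by omega⟩ : Fin n) ⟨b + 1, hb⟩ =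
        swap ⟨b, by omega⟩ ⟨b + 1, hb⟩ * swap ⟨a, by omega⟩ ⟨b, by omega⟩ *
          swap ⟨b, by omega⟩ ⟨b + 1, hb⟩ := by
      ext x
      simp only [Perm.mul_apply, swap_apply_def]
      grind
    rw [h3, map_mul, map_mul]
    exact (h2.mul_left (ih (by omega))).mul_left h2

/-- The stabiliser of the first two strands is generated by transpositions of the other strands,
which commute with the first `t`. Hence the conjugate of this `t` by `π` depends only on the images
under `π` of the first two strands. -/
theorem commute_of_apply_eq (h : 1 < n) {σ : Perm (Fin n)} (h0 : σ ⟨0, by omega⟩ = ⟨0, by omega⟩)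
    (h1 : σ ⟨1, by omega⟩ = ⟨1, by omega⟩) :
    Commute (permHom d n σ) (genT d n ⟨0, by omega⟩) := by
  induction hk : σ.support.card using Nat.strong_induction_on generalizing σ with
  | _ k ih =>
  subst hk
  by_cases hσ : σ = 1
  · subst hσ; rw [map_one]; exact Commute.one_left _
  obtain ⟨x, hx⟩ : ∃ x, σ x ≠ x := by
    by_contra! hc
    exact hσ (Equiv.ext hc)
  have hx0 : x ≠ ⟨0, by omega⟩ := by rintro rfl; exact hx h0
  have hx1 : x ≠ ⟨1, by omega⟩ := by rintro rfl; exact hx h1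
  have hy0 : σ x ≠ ⟨0, by omega⟩ := fun e => hx0 (σ.injective (e.trans h0.symm))
  have hy1 : σ x ≠ ⟨1, by omega⟩ := fun e => hx1 (σ.injective (e.trans h1.symm))
  have e1 : Commute (permHom d n (swap x (σ x))) (genT d n ⟨0, by omega⟩) := by
    generalize σ x = y at *
    have hx2 : 2 ≤ x.1 := by simp [Fin.ext_iff] at hx0 hx1; omega
    have hy2 : 2 ≤ y.1 := by simp [Fin.ext_iff] at hy0 hy1; omega
    rcases lt_or_gt_of_ne hx with hlt | hlt
    · rw [swap_comm]; exact commute_swap_of_le h hy2 hlt x.2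
    · exact commute_swap_of_le h hx2 hlt y.2
  have e2 : Commute (permHom d n (swap x (σ x) * σ)) (genT d n ⟨0, by omega⟩) := by
    refine ih _ (Perm.card_support_swap_mul hx) ?_ ?_ rfl
    · rw [Perm.mul_apply, h0, swap_apply_of_ne_of_ne hx0.symm hy0.symm]
    · rw [Perm.mul_apply, h1, swap_apply_of_ne_of_ne hx1.symm hy1.symm]
  have e3 := e1.mul_left e2
  rwa [← map_mul, ← mul_assoc, swap_mul_self, one_mul] at e3

theorem exists_genT_eq_conj (h : 1 < n) (i : ℕ) (hi : i < n - 1) :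
    ∃ π : Perm (Fin n), π ⟨0, by omega⟩ = left ⟨i, hi⟩ ∧ π ⟨1, by omega⟩ = right ⟨i, hi⟩ ∧
      permHom d n π * genT d n ⟨0, by omega⟩ = genT d n ⟨i, hi⟩ * permHom d n π := by
  induction i with
  | zero => exact ⟨1, rfl, rfl, by rw [map_one, one_mul, mul_one]⟩
  | succ i ih =>
    obtain ⟨π, h0, h1, e⟩ := ih (by omega)
    -- With `a = s i` and `b = s (i + 1)`, the product `a * b` conjugates `t i` to `t (i + 1)`,
    -- because `b * t i * b = a * t (i + 1) * a`.
    refine ⟨swap (left ⟨i, by omega⟩) (right ⟨i, by omega⟩) *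
      swap (left ⟨i + 1, hi⟩) (right ⟨i + 1, hi⟩) * π, ?_, ?_, ?_⟩
    · rw [Perm.mul_apply, Perm.mul_apply, h0]
      simp only [left, right, swap_apply_def, Fin.ext_iff]
      grind
    · rw [Perm.mul_apply, Perm.mul_apply, h1]
      simp only [left, right, swap_apply_def, Fin.ext_iff]
      grind
    · have h2 := genS_mul_genT_mul_genS (d := d) (i := ⟨i, by omega⟩) (j := ⟨i + 1, hi⟩)
        (Or.inl rfl)
      simp only [map_mul, permHom_swap]
      have hb := genS_mul_self (d := d) (⟨i + 1, hi⟩ : Fin (n - 1))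
      have ha := genS_mul_self (d := d) (⟨i, by omega⟩ : Fin (n - 1))
      rw [mul_assoc, e, ← mul_assoc, ← mul_assoc, ← mul_assoc]
      congr 1
      generalize genS d n ⟨i, by omega⟩ = a at *
      generalize genS d n ⟨i + 1, hi⟩ = b at *
      generalize genT d n ⟨i, by omega⟩ = t at *
      generalize genT d n ⟨i + 1, hi⟩ = u at *
      calc a * b * t = a * (b * t * b) * b := by simp only [mul_assoc, hb, mul_one]
        _ = (a * a) * u * a * b := by rw [← h2]; simp only [mul_assoc]
        _ = u * a * b := by rw [ha, one_mul]

theorem permHom_right_cancel (π : Perm (Fin n)) {x y : FramedBrauerMonoid d n}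
    (e : x * permHom d n π = y * permHom d n π) : x = y := by
  have := congrArg (· * permHom d n π⁻¹) e
  simpa only [mul_assoc, ← map_mul, mul_inv_cancel, map_one, mul_one] using this

/-- `T a b` is the conjugate of the first `t` by any permutation sending the first two strands to
`a` and `b`. Well-definedness gives both the equivariance and the value `t i` on adjacent strands.
-/
theorem exists_hook (d n : ℕ) : ∃ T : Fin n → Fin n → FramedBrauerMonoid d n,
    (∀ i, T (left i) (right i) = genT d n i) ∧
    ∀ (π : Perm (Fin n)) (a b : Fin n), a ≠ b →
      permHom d n π * T a b = T (π a) (π b) * permHom d n π := by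
  by_cases h : 1 < n
  · have hp : ∀ a b : Fin n, a ≠ b →
        ∃ π : Perm (Fin n), π ⟨0, by omega⟩ = a ∧ π ⟨1, by omega⟩ = b := by
      intro a b hab
      obtain ⟨π, hπ⟩ := exists_perm_map_eq [⟨0, by omega⟩, ⟨1, by omega⟩] [a, b]
        (by simp [Fin.ext_iff]) (by simpa using hab) rfl
      exact ⟨π, by simpa using hπ⟩
    have hT : ∀ a b : Fin n, ∃ t : FramedBrauerMonoid d n, a ≠ b →
        ∀ π : Perm (Fin n), π ⟨0, by omega⟩ = a → π ⟨1, by omega⟩ = b →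
          permHom d n π * genT d n ⟨0, by omega⟩ = t * permHom d n π := by
      intro a b
      by_cases hab : a = b
      · exact ⟨1, fun h => (h hab).elim⟩
      obtain ⟨ρ, h0, h1⟩ := hp a b hab
      refine ⟨permHom d n ρ * genT d n ⟨0, by omega⟩ * permHom d n ρ⁻¹, fun _ π g0 g1 => ?_⟩
      have hc := commute_of_apply_eq (d := d) h (σ := ρ⁻¹ * π)
        (by rw [Perm.mul_apply, g0, ← h0]; simp) (by rw [Perm.mul_apply, g1, ← h1]; simp)
      rw [mul_assoc, ← map_mul, mul_assoc, ← hc.eq, ← mul_assoc, ← map_mul, mul_inv_cancel_left]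
    choose T hT using hT
    refine ⟨T, fun i => ?_, fun π a b hab => ?_⟩
    · obtain ⟨π, h0, h1, e⟩ := exists_genT_eq_conj (d := d) h i i.2
      have hne : left i ≠ right i := by simp [left, right, Fin.ext_iff]
      exact permHom_right_cancel π ((hT _ _ hne π h0 h1).symm.trans e)
    · obtain ⟨ρ, h0, h1⟩ := hp a b hab
      apply permHom_right_cancel ρ
      rw [mul_assoc, ← hT a b hab ρ h0 h1, mul_assoc, ← map_mul, ← mul_assoc, ← map_mul]
      exact hT _ _ (π.injective.ne hab) (π * ρ) (by rw [Perm.mul_apply, h0])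
        (by rw [Perm.mul_apply, h1])
  · refine ⟨fun _ _ => 1, fun i => ?_, fun π a b hab => ?_⟩
    · have := i.2; omega
    · have := a.2; have := b.2; omega

variable (d) in
/-- The element obtained by conjugating the generators `t i` so that it acts on the strands
`a ≠ b`. -/
noncomputable def hook (a b : Fin n) : FramedBrauerMonoid d n := (exists_hook d n).choose a b

theorem hook_left_right (i : Fin (n - 1)) : hook d (left i) (right i) = genT d n i :=
  (exists_hook d n).choose_spec.1 i

theorem permHom_mul_hook (π : Perm (Fin n)) {a b : Fin n} (h : a ≠ b) :
    permHom d n π * hook d a b = hook d (π a) (π b) * permHom d n π :=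
  (exists_hook d n).choose_spec.2 π a b h

theorem permHom_mul_swap (π : Perm (Fin n)) (a b : Fin n) :
    permHom d n π * permHom d n (swap a b) = permHom d n (swap (π a) (π b)) * permHom d n π := by
  rw [← map_mul, ← map_mul, mul_swap_eq_swap_mul]

theorem exists_perm_pair {a b : Fin n} (h : a ≠ b) :
    ∃ (i : Fin (n - 1)) (π : Perm (Fin n)), π (left i) = a ∧ π (right i) = b := by
  have hn : 0 < n - 1 := by
    have := a.2; have := b.2; omega
  obtain ⟨π, hπ⟩ := exists_perm_map_eq [left ⟨0, hn⟩, right ⟨0, hn⟩] [a, b]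
    (by simp [left, right, Fin.ext_iff]) (by simpa using h) rfl
  exact ⟨_, π, by simpa using hπ⟩

theorem exists_perm_triple {a b c : Fin n} (h : [a, b, c].Nodup) :
    ∃ (i j : Fin (n - 1)) (π : Perm (Fin n)), Near i j ∧ right i = left j ∧
      π (left i) = a ∧ π (right i) = b ∧ π (right j) = c := by
  have hn : 1 < n - 1 := by
    have := h.length_le_card; simp at this; omega
  obtain ⟨π, hπ⟩ := exists_perm_map_eq
    [left ⟨0, by omega⟩, right ⟨0, by omega⟩, right ⟨1, hn⟩] [a, b, c]
    (by simp [left, right, Fin.ext_iff]) h rfl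
  exact ⟨_, _, π, Or.inl rfl, rfl, by simpa using hπ⟩

theorem exists_perm_quadruple {a b c e : Fin n} (h : [a, b, c, e].Nodup) :
    ∃ (i j : Fin (n - 1)) (π : Perm (Fin n)), Far i j ∧
      π (left i) = a ∧ π (right i) = b ∧ π (left j) = c ∧ π (right j) = e := by
  have hn : 2 < n - 1 := by
    have := h.length_le_card; simp at this; omega
  obtain ⟨π, hπ⟩ := exists_perm_map_eq
    [left ⟨0, by omega⟩, right ⟨0, by omega⟩, left ⟨2, hn⟩, right ⟨2, hn⟩] [a, b, c, e]
    (by simp [left, right, Fin.ext_iff]) h rfl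
  exact ⟨⟨0, by omega⟩, ⟨2, hn⟩, π, Or.inl (by simp), by simpa using hπ⟩

theorem left_ne_right (i : Fin (n - 1)) : left i ≠ right i := by simp [left, right, Fin.ext_iff]

/-- The hook identities below follow one pattern: multiply by `π` on the right, move it to the left
by equivariance, and use a defining relation at standard positions. -/
theorem permHom_swap_mul_hook {a b : Fin n} (h : a ≠ b) :
    permHom d n (swap a b) * hook d a b = hook d a b := by
  obtain ⟨i, π, rfl, rfl⟩ := exists_perm_pair h
  apply permHom_right_cancel π
  rw [mul_assoc, ← permHom_mul_hook _ (left_ne_right i), ← mul_assoc, ← permHom_mul_swap,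
    mul_assoc, permHom_swap, hook_left_right, genS_mul_genT]

theorem hook_mul_permHom_swap {a b : Fin n} (h : a ≠ b) :
    hook d a b * permHom d n (swap a b) = hook d a b := by
  obtain ⟨i, π, rfl, rfl⟩ := exists_perm_pair h
  apply permHom_right_cancel π
  rw [mul_assoc, ← permHom_mul_swap, ← mul_assoc, ← permHom_mul_hook _ (left_ne_right i),
    mul_assoc, permHom_swap, hook_left_right, genT_mul_genS]

theorem hook_comm {a b : Fin n} (h : a ≠ b) : hook d a b = hook d b a := by
  have h1 := permHom_mul_hook (d := d) (swap a b) h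
  rw [swap_apply_left, swap_apply_right, permHom_swap_mul_hook h] at h1
  rw [h1, swap_comm, hook_mul_permHom_swap h.symm]

theorem hook_commute_hook {a b c e : Fin n} (h : [a, b, c, e].Nodup) :
    Commute (hook d a b) (hook d c e) := by
  obtain ⟨i, j, π, hij, rfl, rfl, rfl, rfl⟩ := exists_perm_quadruple h
  apply permHom_right_cancel π
  rw [mul_assoc, ← permHom_mul_hook _ (left_ne_right j), ← mul_assoc,
    ← permHom_mul_hook _ (left_ne_right i), mul_assoc, hook_left_right, hook_left_right,
    genT_mul_genT_of_far hij, mul_assoc (hook _ _ _), ← permHom_mul_hook _ (left_ne_right i),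
    ← mul_assoc (hook _ _ _), ← permHom_mul_hook _ (left_ne_right j), mul_assoc, hook_left_right,
    hook_left_right]

/-- This reduces two hooks with a common end to one hook, and comes from `s i * t j * t i = s j * t
i`. -/
theorem hook_mul_hook {a b c : Fin n} (h : [a, b, c].Nodup) :
    hook d a c * hook d a b = permHom d n (swap b c) * hook d a b := by
  -- The shared end `a` has to be the middle one of three consecutive strands.
  have h' : [b, a, c].Nodup := by simp at h ⊢; grind
  obtain ⟨i, j, π, hij, hr, rfl, rfl, rfl⟩ := exists_perm_triple h'
  have hab : right i ≠ left i := (left_ne_right i).symm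
  apply permHom_right_cancel π
  rw [mul_assoc, mul_assoc, ← permHom_mul_hook _ hab, ← mul_assoc, ← mul_assoc,
    ← permHom_mul_swap, hr, ← permHom_mul_hook _ (left_ne_right j), mul_assoc, mul_assoc, ← hr,
    hook_comm hab, hook_left_right, hr, hook_left_right]
  congr 1
  have h1 := genS_mul_genT_mul_genT (d := d) hij
  have h2 : swap (left i) (right j) = swap (left i) (right i) * swap (left j) (right j) *
      swap (left i) (right i) := by
    ext x
    simp only [← hr, Perm.mul_apply, swap_apply_def]
    simp at h'
    have : right j ≠ right i := by grind
    have : right j ≠ left i := by grind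
    grind
  rw [h2, map_mul, map_mul, permHom_swap, permHom_swap, mul_assoc, genS_mul_genT, mul_assoc, ← h1,
    ← mul_assoc, ← mul_assoc, genS_mul_self, one_mul]

theorem hook_mul_hook' {a b c : Fin n} (h : [a, b, c].Nodup) :
    hook d a b * hook d a c = hook d a b * permHom d n (swap b c) := by
  have hbc : a ≠ b ∧ a ≠ c := by simp at h; grind
  have hc : hook d a b * permHom d n (swap b c) = permHom d n (swap b c) * hook d a c := by
    rw [permHom_mul_hook _ hbc.2, swap_apply_right, swap_apply_of_ne_of_ne hbc.1 hbc.2]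
  rw [hc, swap_comm]
  exact hook_mul_hook (by simp at h ⊢; grind)

variable [NeZero d]

theorem hook_mul_zVec_mul_hook {a b : Fin n} (h : a ≠ b) (k : ZMod d) :
    hook d a b * zVec (Pi.single a k) * hook d a b = hook d a b := by
  obtain ⟨i, π, rfl, rfl⟩ := exists_perm_pair h
  apply permHom_right_cancel π
  rw [mul_assoc, ← permHom_mul_hook _ (left_ne_right i), zVec_single]
  rw [← mul_assoc, mul_assoc (hook _ _ _), ← (SemiconjBy.pow_right (permHom_mul_genZ π _) _),
    ← mul_assoc, ← permHom_mul_hook _ (left_ne_right i), hook_left_right, mul_assoc, mul_assoc,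
    ← mul_assoc (genT d n i), genT_mul_genZ_pow_mul_genT]

theorem hook_mul_zVec_single {a b : Fin n} (h : a ≠ b) (k : ZMod d) :
    hook d a b * zVec (Pi.single a k) = hook d a b * zVec (Pi.single b k) := by
  have h1 : hook d a b * genZ d n a = hook d a b * genZ d n b := by
    obtain ⟨i, π, rfl, rfl⟩ := exists_perm_pair h
    apply permHom_right_cancel π
    rw [mul_assoc, mul_assoc, ← permHom_mul_genZ, ← permHom_mul_genZ, ← mul_assoc, ← mul_assoc,
      ← permHom_mul_hook _ (left_ne_right i), hook_left_right, mul_assoc, mul_assoc,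
      genT_mul_genZ]
  rw [zVec_single, zVec_single]
  generalize k.val = k
  induction k with
  | zero => simp
  | succ k ih =>
    rw [pow_succ, ← mul_assoc, ih, mul_assoc, ← ((genZ_commute a b).pow_right k).eq, ← mul_assoc,
      h1, mul_assoc, ← pow_succ']

theorem zVec_single_mul_hook {a b : Fin n} (h : a ≠ b) (k : ZMod d) :
    zVec (Pi.single a k) * hook d a b = zVec (Pi.single b k) * hook d a b := by
  have h1 : genZ d n a * hook d a b = genZ d n b * hook d a b := by
    obtain ⟨i, π, rfl, rfl⟩ := exists_perm_pair h
    apply permHom_right_cancel π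
    rw [mul_assoc, mul_assoc, ← permHom_mul_hook _ (left_ne_right i), ← mul_assoc, ← mul_assoc,
      ← permHom_mul_genZ, ← permHom_mul_genZ, hook_left_right, mul_assoc, mul_assoc,
      genZ_mul_genT]
  rw [zVec_single, zVec_single]
  generalize k.val = k
  induction k with
  | zero => simp
  | succ k ih =>
    rw [pow_succ, mul_assoc, h1, ← mul_assoc, ((genZ_commute a b).pow_left k).eq, mul_assoc,
      ih, ← mul_assoc, ← pow_succ']

theorem zVec_commute_hook {a b : Fin n} (h : a ≠ b) {α : Fin n → ZMod d} (ha : α a = 0)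
    (hb : α b = 0) : Commute (zVec α) (hook d a b) := by
  refine zVec_induction (P := fun α => Commute (zVec α) (hook d a b)) α ?_ (fun α β hα hβ => ?_)
    (fun j => ?_)
  · rw [zVec_zero]; exact Commute.one_left _
  · rw [zVec_add]; exact hα.mul_left hβ
  · by_cases hja : j = a
    · rw [hja, ha, Pi.single_zero, zVec_zero]; exact Commute.one_left _
    by_cases hjb : j = b
    · rw [hjb, hb, Pi.single_zero, zVec_zero]; exact Commute.one_left _
    rw [zVec_single]
    refine Commute.pow_left ?_ _
    obtain ⟨i, π, rfl, rfl⟩ := exists_perm_pair h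
    obtain ⟨j, rfl⟩ := π.surjective j
    have hc : Commute (genZ d n j) (genT d n i) :=
      genZ_commute_genT (fun e => hja (by rw [e])) (fun e => hjb (by rw [e]))
    apply permHom_right_cancel π
    rw [mul_assoc, ← permHom_mul_hook _ (left_ne_right i), ← mul_assoc, ← permHom_mul_genZ,
      mul_assoc, hook_left_right, hc.eq, mul_assoc (hook _ _ _), ← permHom_mul_genZ,
      ← mul_assoc (hook _ _ _), ← permHom_mul_hook _ (left_ne_right i), hook_left_right, mul_assoc]

end Hooks

/-! ### Products of disjoint hooks and the permutations they absorb -/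

section NormalForm

open Equiv

/-- The end points of a list of arcs. -/
def ends {V : Type*} : List (V × V) → List V
  | [] => []
  | p :: l => p.1 :: p.2 :: ends l

/-- The unordered pair `{a, b}` occurs in the list `l`. -/
def IsArc {V : Type*} (l : List (V × V)) (a b : V) : Prop := (a, b) ∈ l ∨ (b, a) ∈ l

section Arcs

variable {V : Type*} {l l' : List (V × V)} {a b c : V}

theorem IsArc.symm (h : IsArc l a b) : IsArc l b a := Or.symm h

theorem isArc_cons {p : V × V} : IsArc (p :: l) a b ↔ p = (a, b) ∨ p = (b, a) ∨ IsArc l a b := by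
  simp only [IsArc, List.mem_cons]
  grind

theorem not_isArc_nil : ¬ IsArc [] a b := by simp [IsArc]

theorem ends_perm (h : l.Perm l') : (ends l).Perm (ends l') := by
  induction h with
  | nil => exact .refl _
  | cons p _ ih => exact (ih.cons _).cons _
  | swap p q l =>
    exact (List.perm_append_comm (l₁ := [q.1, q.2]) (l₂ := [p.1, p.2])).append_right (ends l)
  | trans _ _ h1 h2 => exact h1.trans h2

theorem isArc_perm (h : l.Perm l') : IsArc l a b ↔ IsArc l' a b := by
  simp only [IsArc, h.mem_iff]

theorem ends_map {W : Type*} (f : V → W) (l : List (V × V)) :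
    ends (l.map (Prod.map f f)) = (ends l).map f := by
  induction l with
  | nil => rfl
  | cons p l ih => simp [ends, ih]

theorem mem_ends_of_isArc (h : IsArc l a b) : a ∈ ends l := by
  induction l with
  | nil => exact (not_isArc_nil h).elim
  | cons p l ih =>
    rw [isArc_cons] at h
    rcases h with rfl | rfl | h
    · simp [ends]
    · simp [ends]
    · simp [ends, ih h]

theorem exists_isArc_of_mem_ends (h : a ∈ ends l) : ∃ b, IsArc l a b := by
  induction l with
  | nil => simp [ends] at h
  | cons p l ih =>
    simp only [ends, List.mem_cons] at h
    rcases h with rfl | rfl | h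
    · exact ⟨p.2, isArc_cons.2 (Or.inl rfl)⟩
    · exact ⟨p.1, isArc_cons.2 (Or.inr (Or.inl rfl))⟩
    · obtain ⟨b, hb⟩ := ih h
      exact ⟨b, isArc_cons.2 (Or.inr (Or.inr hb))⟩

variable (hl : (ends l).Nodup)
include hl

theorem IsArc.ne (h : IsArc l a b) : a ≠ b := by
  induction l with
  | nil => exact (not_isArc_nil h).elim
  | cons p l ih =>
    rw [isArc_cons] at h
    simp only [ends, List.nodup_cons, List.mem_cons, not_or] at hl
    rcases h with rfl | rfl | h
    · exact hl.1.1
    · exact Ne.symm hl.1.1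
    · exact ih hl.2.2 h

theorem IsArc.unique (h : IsArc l a b) (h' : IsArc l a c) : b = c := by
  induction l with
  | nil => exact (not_isArc_nil h).elim
  | cons p l ih =>
    rw [isArc_cons] at h h'
    simp only [ends, List.nodup_cons, List.mem_cons, not_or] at hl
    have h1 : ∀ x y, IsArc l x y → x ∈ ends l := fun x y => mem_ends_of_isArc
    have h2 : ∀ x y, IsArc l x y → y ∈ ends l := fun x y h => mem_ends_of_isArc h.symm
    grind

end Arcs

variable {d n : ℕ}

variable (d) in
/-- The product of the elements `hook a b` over the arcs in a list. -/
noncomputable def hooks : List (Fin n × Fin n) → FramedBrauerMonoid d n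
  | [] => 1
  | p :: l => hook d p.1 p.2 * hooks l

variable {l l' : List (Fin n × Fin n)} {a b c : Fin n}

theorem hook_commute_hooks (h : (a :: b :: ends l).Nodup) :
    Commute (hook d a b) (hooks d l) := by
  induction l with
  | nil => exact Commute.one_right _
  | cons p l ih =>
    rw [hooks]
    refine Commute.mul_right (hook_commute_hook ?_) (ih ?_)
    · exact h.sublist (by simp [ends])
    · refine h.sublist ?_
      simp only [ends, List.cons_sublist_cons]
      exact (List.sublist_cons_self _ _).trans (List.sublist_cons_self _ _)

theorem hooks_perm (hl : (ends l).Nodup) (h : l.Perm l') : hooks d l = hooks d l' := by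
  induction h with
  | nil => rfl
  | cons p _ ih => rw [hooks, hooks, ih (by simp only [ends, List.nodup_cons] at hl; exact hl.2.2)]
  | swap p q l =>
    rw [hooks, hooks, hooks, hooks, ← mul_assoc, ← mul_assoc, (hook_commute_hook _).eq]
    exact hl.sublist (by simp [ends])
  | trans h1 _ ih1 ih2 => rw [ih1 hl, ih2 ((ends_perm h1).nodup_iff.1 hl)]

theorem permHom_mul_hooks (π : Perm (Fin n)) (hl : (ends l).Nodup) :
    permHom d n π * hooks d l = hooks d (l.map (Prod.map π π)) * permHom d n π := by
  induction l with
  | nil => simp [hooks]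
  | cons p l ih =>
    simp only [ends, List.nodup_cons, List.mem_cons, not_or] at hl
    rw [List.map_cons, hooks, hooks, ← mul_assoc, permHom_mul_hook π hl.1.1, mul_assoc,
      ih hl.2.2, ← mul_assoc]
    rfl

/-- An arc of a list can be moved to the front. -/
theorem exists_hooks_eq (hl : (ends l).Nodup) (h : IsArc l a b) :
    ∃ l', (a :: b :: ends l').Nodup ∧ hooks d l = hook d a b * hooks d l' ∧
      (∀ x, x ∈ ends l ↔ x = a ∨ x = b ∨ x ∈ ends l') ∧
      ∀ x y, IsArc l x y ↔ x = a ∧ y = b ∨ x = b ∧ y = a ∨ IsArc l' x y := by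
  have key : ∀ p ∈ l, ∃ l', (p.1 :: p.2 :: ends l').Nodup ∧
      hooks d l = hook d p.1 p.2 * hooks d l' ∧
      (∀ x, x ∈ ends l ↔ x = p.1 ∨ x = p.2 ∨ x ∈ ends l') ∧
      ∀ x y, IsArc l x y ↔ x = p.1 ∧ y = p.2 ∨ x = p.2 ∧ y = p.1 ∨ IsArc l' x y := by
    intro p hp
    have h1 := List.perm_cons_erase hp
    refine ⟨l.erase p, (ends_perm h1).nodup_iff.1 hl, hooks_perm hl h1, fun x => ?_, fun x y => ?_⟩
    · rw [(ends_perm h1).mem_iff]; simp [ends]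
    · rw [isArc_perm h1, isArc_cons]
      grind
  rcases h with h | h
  · exact key _ h
  · obtain ⟨l', h1, h2, h3, h4⟩ := key _ h
    simp only at h1 h2 h3 h4
    refine ⟨l', (List.Perm.swap _ _ _).nodup_iff.1 h1, ?_, by grind, by grind⟩
    rw [h2, hook_comm]
    simp at h1; grind

/-- Disjoint hooks commute and `h a b = h b a`, so the product depends only on the set of unordered
arcs. -/
theorem hooks_eq_of_isArc_iff (hl : (ends l).Nodup) (hl' : (ends l').Nodup)
    (h : ∀ a b, IsArc l a b ↔ IsArc l' a b) : hooks d l = hooks d l' := by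
  induction hk : l.length generalizing l l' with
  | zero =>
    cases l with
    | cons => simp at hk
    | nil =>
    cases l' with
    | nil => rfl
    | cons p l' => exact (not_isArc_nil ((h p.1 p.2).2 (isArc_cons.2 (Or.inl rfl)))).elim
  | succ k ih =>
    cases l with
    | nil => simp at hk
    | cons p l =>
    have h1 : IsArc l' p.1 p.2 := (h p.1 p.2).1 (isArc_cons.2 (Or.inl rfl))
    obtain ⟨l'', h2, h3, h4, h5⟩ := exists_hooks_eq (d := d) hl' h1
    have h6 : ∀ x y, IsArc l x y → x ∈ ends l := fun x y => mem_ends_of_isArc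
    have h7 : ∀ x y, IsArc l'' x y → x ∈ ends l'' := fun x y => mem_ends_of_isArc
    simp only [ends, List.nodup_cons, List.mem_cons, not_or] at hl h2
    rw [h3, hooks, ih hl.2.2 h2.2.2 ?_ (by simpa using hk)]
    intro a b
    have h8 := h a b
    rw [isArc_cons, h5] at h8
    grind

/-- Exchanging two arcs is absorbed: multiplying `h x y * h u v` on the right by `(y v)` or by `(x
u)` gives the same element, `h x y * h u v * h x v`. -/
theorem hook_mul_hook_mul_swap_mul_swap {x y u v : Fin n} (h : [x, y, u, v].Nodup) :
    hook d x y * hook d u v * permHom d n (swap y v) * permHom d n (swap x u) =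
      hook d x y * hook d u v := by
  have h1 : hook d x y * hook d u v * permHom d n (swap y v) =
      hook d x y * hook d u v * permHom d n (swap x u) := by
    have hxy : [x, y, v].Nodup := by simp at h ⊢; grind
    have hxv : [v, u, x].Nodup := by simp at h ⊢; grind
    have hne : x ≠ v ∧ u ≠ v := by simp at h; grind
    rw [(hook_commute_hook h).eq, mul_assoc, ← hook_mul_hook' hxy, ← mul_assoc,
      ← (hook_commute_hook h).eq, mul_assoc, mul_assoc, hook_comm hne.1, hook_comm hne.2,
      hook_mul_hook' hxv, swap_comm]
  rw [h1, mul_assoc, ← map_mul, swap_mul_self, map_one, mul_one]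

theorem hooks_mul_permHom_swap (hl : (ends l).Nodup) (h : IsArc l a b) :
    hooks d l * permHom d n (swap a b) = hooks d l := by
  obtain ⟨l', h1, h2, -, -⟩ := exists_hooks_eq (d := d) hl h
  rw [h2, (hook_commute_hooks h1).eq, mul_assoc, hook_mul_permHom_swap (h.ne hl)]

theorem hooks_mul_permHom_swap_mul_swap {x y u v : Fin n} (hl : (ends l).Nodup) (h : IsArc l x y)
    (h' : IsArc l u v) (hu : u ≠ x) (hu' : u ≠ y) :
    hooks d l * permHom d n (swap y v * swap x u) = hooks d l := by
  obtain ⟨l', h1, h2, h3, h4⟩ := exists_hooks_eq (d := d) hl h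
  have h5 : IsArc l' u v := by grind
  have h1' := h1
  simp only [List.nodup_cons, List.mem_cons, not_or] at h1'
  obtain ⟨l'', g1, g2, g3, g4⟩ := exists_hooks_eq (d := d) h1'.2.2 h5
  have g5 := g1
  simp only [List.nodup_cons, List.mem_cons, not_or] at g5
  have hn : (x :: y :: ends l'').Nodup := by simp only [List.nodup_cons, List.mem_cons]; grind
  have hn' : [x, y, u, v].Nodup := by simp; grind
  rw [h2, g2, (hook_commute_hooks g1).eq, ← mul_assoc, (hook_commute_hooks hn).eq, map_mul,
    mul_assoc, mul_assoc, ← mul_assoc (hook d u v), ← mul_assoc, ← mul_assoc,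
    mul_assoc (hooks d l''), mul_assoc (hooks d l''), mul_assoc (hooks d l'')]
  congr 1
  rw [← mul_assoc, hook_mul_hook_mul_swap_mul_swap hn']

/-- The permutations that preserve the arcs of `l` and fix all other points are absorbed. -/
theorem hooks_mul_permHom {σ : Perm (Fin n)} (hl : (ends l).Nodup)
    (hσ : ∀ a b, IsArc l a b → IsArc l (σ a) (σ b)) (hfix : ∀ a, a ∉ ends l → σ a = a) :
    hooks d l * permHom d n σ = hooks d l := by
  induction hk : σ.support.card using Nat.strong_induction_on generalizing σ with
  | _ k ih =>
  subst hk
  by_cases h1 : σ = 1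
  · rw [h1, map_one, mul_one]
  obtain ⟨x, hx⟩ : ∃ x, σ x ≠ x := by
    by_contra! hc
    exact h1 (Equiv.ext hc)
  obtain ⟨y, hy⟩ : ∃ y, IsArc l x y :=
    exists_isArc_of_mem_ends (by by_contra hc; exact hx (hfix x hc))
  have hu : ∀ {a b c}, IsArc l a b → IsArc l a c → b = c := fun h h' => h.unique hl h'
  have hs : ∀ {a b}, IsArc l a b → IsArc l b a := fun h => h.symm
  have hm : ∀ {a b}, IsArc l a b → a ∈ ends l := mem_ends_of_isArc
  have hne : ∀ {a b}, IsArc l a b → a ≠ b := fun h => h.ne hl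
  have huv := hσ x y hy
  -- It suffices to find an absorbed `ρ` that undoes `σ` at `x`: then `ρ * σ` has smaller support.
  -- If `σ x = y`, take the flip of the arc `{x, y}`; otherwise take the exchange of the arcs `{x,
  -- y}` and `{σ x, σ y}`.
  have key : ∀ ρ : Perm (Fin n), hooks d l * permHom d n ρ = hooks d l →
      (∀ a, a ≠ x → a ≠ y → a ≠ σ x → a ≠ σ y → ρ a = a) → ρ (σ x) = x →
      (∀ a b, IsArc l a b → IsArc l (ρ a) (ρ b)) → hooks d l * permHom d n σ = hooks d l := by
    intro ρ h1 h2 h3 h5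
    have h6 := ih _ ?_ (σ := ρ * σ) (fun a b h => h5 _ _ (hσ a b h)) ?_ rfl
    · rwa [map_mul, ← mul_assoc, h1] at h6
    · refine Finset.card_lt_card ((Finset.ssubset_iff_of_subset ?_).2 ⟨x, ?_, ?_⟩)
      · intro e he
        rw [Perm.mem_support] at he ⊢
        intro hee
        apply he
        rw [Perm.mul_apply, hee]
        have i1 : e ≠ x := by rintro rfl; exact hx hee
        have i2 : e ≠ y := by
          rintro rfl
          rw [hee] at huv
          exact hx (hu (hs huv) (hs hy))
        refine h2 e i1 i2 ?_ ?_
        · intro h; exact i1 (σ.injective (hee.trans h))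
        · intro h; exact i2 (σ.injective (hee.trans h))
      · exact Perm.mem_support.2 hx
      · rw [Perm.notMem_support, Perm.mul_apply, h3]
    · intro a ha
      rw [Perm.mul_apply, hfix a ha]
      refine h2 a ?_ ?_ ?_ ?_
      · rintro rfl; exact ha (hm hy)
      · rintro rfl; exact ha (hm (hs hy))
      · rintro rfl; exact ha (hm huv)
      · rintro rfl; exact ha (hm (hs huv))
  generalize σ x = u at *
  generalize σ y = v at *
  clear hσ hfix ih
  by_cases huy : u = y
  · subst huy
    have hvx : v = x := hu huv (hs hy)
    subst hvx
    refine key (swap v u) (hooks_mul_permHom_swap hl hy) ?_ (swap_apply_right _ _) ?_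
    · intro a h1 h2 h3 h4
      exact swap_apply_of_ne_of_ne h1 h2
    · intro a b h
      rw [swap_apply_def, swap_apply_def]
      grind
  · have : x ≠ y := hne hy
    have : u ≠ v := hne huv
    have : v ≠ x := by rintro rfl; exact huy (hu (hs huv) hy)
    have : v ≠ y := by rintro rfl; exact hx (hu (hs huv) (hs hy))
    refine key (swap y v * swap x u) (hooks_mul_permHom_swap_mul_swap hl hy huv hx huy)
      ?_ ?_ ?_
    · intro a h1 h2 h3 h4
      rw [Perm.mul_apply, swap_apply_of_ne_of_ne h1 h3, swap_apply_of_ne_of_ne h2 h4]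
    · rw [Perm.mul_apply, swap_apply_right, swap_apply_of_ne_of_ne] <;> grind
    · intro a b h
      simp only [Perm.mul_apply, swap_apply_def]
      grind

end NormalForm

/-! ### Normal forms with framings -/

section FramedNormalForm

open Equiv

variable {d n : ℕ} [NeZero d] {l : List (Fin n × Fin n)} {a b c : Fin n}

theorem zVec_commute_hooks (hl : (ends l).Nodup) {α : Fin n → ZMod d}
    (h : ∀ a ∈ ends l, α a = 0) : Commute (zVec α) (hooks d l) := by
  induction l with
  | nil => exact Commute.one_right _
  | cons p l ih =>
    simp only [ends, List.nodup_cons, List.mem_cons, not_or] at hl h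
    exact (zVec_commute_hook hl.1.1 (h _ (by simp)) (h _ (by simp))).mul_right
      (ih hl.2.2 fun a ha => h a (by simp [ha]))

theorem exists_zVec_split (hab : a ≠ b) (α : Fin n → ZMod d) :
    ∃ β : Fin n → ZMod d, β a = 0 ∧ β b = 0 ∧ (∀ x, x ≠ a → x ≠ b → β x = α x) ∧
      zVec α = zVec β * zVec (Pi.single a (α a)) * zVec (Pi.single b (α b)) := by
  refine ⟨fun x => if x = a ∨ x = b then 0 else α x, by simp, by simp, ?_, ?_⟩
  · intro x h1 h2
    simp [h1, h2]
  · rw [← zVec_add, ← zVec_add]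
    congr 1
    ext x
    simp only [Pi.add_apply, Pi.single_apply]
    grind

theorem zVec_single_add (k m : ZMod d) :
    zVec (Pi.single a (k + m)) = zVec (Pi.single a k) * zVec (Pi.single a m) := by
  rw [Pi.single_add, zVec_add]

/-- Framings at the two ends of an arc can be collected at one end, where they add up to `0`.
Framings off the arcs commute with the hooks, and the left ones cancel the right ones. -/
theorem zVec_mul_hooks_mul_zVec (hl : (ends l).Nodup) {γ δ : Fin n → ZMod d}
    (hγ : ∀ a b, IsArc l a b → γ a + γ b = 0) (hδ : ∀ a b, IsArc l a b → δ a + δ b = 0)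
    (h : ∀ a, a ∉ ends l → γ a + δ a = 0) :
    zVec γ * hooks d l * zVec δ = hooks d l := by
  induction l generalizing γ δ with
  | nil =>
    have : γ + δ = 0 := funext fun a => h a (by simp [ends])
    rw [hooks, mul_one, ← zVec_add, this, zVec_zero]
  | cons p l ih =>
    obtain ⟨a, b⟩ := p
    have hl' := hl
    simp only [ends, List.nodup_cons, List.mem_cons, not_or] at hl' h
    have hab : a ≠ b := hl'.1.1
    obtain ⟨γ', g1, g2, g3, g4⟩ := exists_zVec_split hab γ
    obtain ⟨δ', d1, d2, d3, d4⟩ := exists_zVec_split hab δ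
    have e1 : γ a + γ b = 0 := hγ a b (isArc_cons.2 (Or.inl rfl))
    have e2 : δ a + δ b = 0 := hδ a b (isArc_cons.2 (Or.inl rfl))
    have hm : ∀ x y, IsArc l x y → x ≠ a ∧ x ≠ b ∧ y ≠ a ∧ y ≠ b := by
      intro x y hxy
      have := mem_ends_of_isArc hxy
      have := mem_ends_of_isArc hxy.symm
      grind
    have h1 := ih hl'.2.2 (γ := γ') (δ := δ')
      (fun x y hxy => by
        obtain ⟨i1, i2, i3, i4⟩ := hm x y hxy
        rw [g3 x i1 i2, g3 y i3 i4]; exact hγ x y (isArc_cons.2 (Or.inr (Or.inr hxy))))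
      (fun x y hxy => by
        obtain ⟨i1, i2, i3, i4⟩ := hm x y hxy
        rw [d3 x i1 i2, d3 y i3 i4]; exact hδ x y (isArc_cons.2 (Or.inr (Or.inr hxy))))
      (fun x hx => by
        by_cases i1 : x = a
        · rw [i1, g1, d1, add_zero]
        by_cases i2 : x = b
        · rw [i2, g2, d2, add_zero]
        rw [g3 x i1 i2, d3 x i1 i2]; exact h x (by grind))
    have h2 : zVec (Pi.single a (γ a)) * zVec (Pi.single b (γ b)) * hook d a b = hook d a b := by
      rw [mul_assoc, ← zVec_single_mul_hook hab, ← mul_assoc, ← zVec_single_add, e1,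
        Pi.single_zero, zVec_zero, one_mul]
    have h3 : hook d a b * (zVec (Pi.single a (δ a)) * zVec (Pi.single b (δ b))) = hook d a b := by
      rw [(zVec_commute _ _).eq, ← mul_assoc, ← hook_mul_zVec_single hab, mul_assoc,
        ← zVec_single_add, add_comm, e2, Pi.single_zero, zVec_zero, mul_one]
    have h4 : Commute (zVec (Pi.single a (δ a)) * zVec (Pi.single b (δ b))) (hooks d l) := by
      rw [← zVec_add]
      refine zVec_commute_hooks hl'.2.2 fun x hx => ?_
      have : x ≠ a := by grind
      have : x ≠ b := by grind
      simp [*]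
    have h5 := zVec_commute_hook hab g1 g2
    calc zVec γ * hooks d ((a, b) :: l) * zVec δ
        = zVec γ' * (zVec (Pi.single a (γ a)) * zVec (Pi.single b (γ b)) * hook d a b) * hooks d l *
          (zVec (Pi.single a (δ a)) * zVec (Pi.single b (δ b)) * zVec δ') := by
          rw [g4, d4, hooks]
          rw [mul_assoc (zVec δ'), ← zVec_add (Pi.single a (δ a)), (zVec_commute δ' _).eq]
          simp only [mul_assoc]
      _ = hook d a b * zVec γ' * (hooks d l *
          (zVec (Pi.single a (δ a)) * zVec (Pi.single b (δ b)))) * zVec δ' := by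
          rw [h2, h5.eq]; simp only [mul_assoc]
      _ = hook d a b * (zVec γ' * zVec (Pi.single a (δ a) + Pi.single b (δ b))) *
          hooks d l * zVec δ' := by
          rw [← h4.eq, zVec_add]; simp only [mul_assoc]
      _ = hook d a b * (zVec (Pi.single a (δ a)) * zVec (Pi.single b (δ b))) *
          (zVec γ' * hooks d l * zVec δ') := by
          rw [(zVec_commute _ _).eq, zVec_add]; simp only [mul_assoc]
      _ = hooks d ((a, b) :: l) := by rw [h3, h1, hooks]

/-- The elements of the form `z^α * T * z^β * π` with `T` a product of disjoint hooks. -/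
def IsNormal (m : FramedBrauerMonoid d n) : Prop :=
  ∃ (α β : Fin n → ZMod d) (l : List (Fin n × Fin n)) (π : Perm (Fin n)), (ends l).Nodup ∧
    m = zVec α * hooks d l * zVec β * permHom d n π

variable {m : FramedBrauerMonoid d n}

theorem isNormal_hooks (hl : (ends l).Nodup) : IsNormal (hooks d l) :=
  ⟨0, 0, l, 1, hl, by rw [zVec_zero, map_one, one_mul, mul_one, mul_one]⟩

theorem IsNormal.zVec_mul (h : IsNormal m) (γ : Fin n → ZMod d) : IsNormal (zVec γ * m) := by
  obtain ⟨α, β, l, π, hl, rfl⟩ := h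
  exact ⟨γ + α, β, l, π, hl, by rw [zVec_add]; simp only [mul_assoc]⟩

theorem IsNormal.mul_zVec (h : IsNormal m) (γ : Fin n → ZMod d) : IsNormal (m * zVec γ) := by
  obtain ⟨α, β, l, π, hl, rfl⟩ := h
  refine ⟨α, β + γ ∘ π.symm, l, π, hl, ?_⟩
  rw [zVec_add, mul_assoc, permHom_mul_zVec]
  simp only [mul_assoc]

theorem IsNormal.mul_permHom (h : IsNormal m) (ρ : Perm (Fin n)) :
    IsNormal (m * permHom d n ρ) := by
  obtain ⟨α, β, l, π, hl, rfl⟩ := h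
  exact ⟨α, β, l, π * ρ, hl, by rw [map_mul]; simp only [mul_assoc]⟩

theorem IsNormal.permHom_mul (h : IsNormal m) (ρ : Perm (Fin n)) :
    IsNormal (permHom d n ρ * m) := by
  obtain ⟨α, β, l, π, hl, rfl⟩ := h
  refine ⟨α ∘ ρ.symm, β ∘ ρ.symm, l.map (Prod.map ρ ρ), ρ * π, ?_, ?_⟩
  · rw [ends_map]; exact hl.map ρ.injective
  · rw [← mul_assoc, ← mul_assoc, ← mul_assoc, permHom_mul_zVec, mul_assoc (zVec _),
      permHom_mul_hooks _ hl, ← mul_assoc, mul_assoc _ (permHom d n ρ), permHom_mul_zVec, map_mul]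
    simp only [mul_assoc]

/-- Let `{b, c}` be the arc at `b`. If `c = a`, a closed loop forms and disappears with its framing.
Otherwise the framing slides along the arc to `c`, past `h a b`, and the two hooks sharing `b`
reduce to one. -/
theorem isNormal_hook_mul_zVec_mul_hooks_of_mem (hl : (ends l).Nodup) (hab : a ≠ b)
    (hb : b ∈ ends l) (k : ZMod d) :
    IsNormal (hook d a b * zVec (Pi.single b k) * hooks d l) := by
  obtain ⟨c, hc⟩ := exists_isArc_of_mem_ends hb
  have hbc : b ≠ c := hc.ne hl
  obtain ⟨l', h1, h2, -, -⟩ := exists_hooks_eq (d := d) hl hc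
  by_cases hca : c = a
  · subst hca
    rw [h2, ← mul_assoc, hook_comm hab, hook_mul_zVec_mul_hook hbc, ← h2]
    exact isNormal_hooks hl
  · have h3 : [b, c, a].Nodup := by simp; grind
    have h4 : hook d a b * zVec (Pi.single b k) * hooks d l =
        zVec (Pi.single c k) * (permHom d n (swap c a) * hooks d l) := by
      have h5 := hook_mul_hook (d := d) h3
      have h6 : Commute (zVec (Pi.single c k)) (hook d a b) :=
        zVec_commute_hook hab (by simp [Ne.symm hca]) (by simp [hbc])
      rw [h2, mul_assoc, ← mul_assoc (zVec _), zVec_single_mul_hook hbc, mul_assoc, ← mul_assoc,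
        ← h6.eq, mul_assoc, hook_comm hab, ← mul_assoc (hook d b a), h5]
      simp only [mul_assoc]
    rw [h4]
    exact ((isNormal_hooks hl).permHom_mul _).zVec_mul _

theorem isNormal_hook_mul_zVec_mul_hooks (hl : (ends l).Nodup) (hab : a ≠ b) (k : ZMod d) :
    IsNormal (hook d a b * zVec (Pi.single b k) * hooks d l) := by
  by_cases hb : b ∈ ends l
  · exact isNormal_hook_mul_zVec_mul_hooks_of_mem hl hab hb k
  by_cases ha : a ∈ ends l
  · rw [← hook_mul_zVec_single hab, hook_comm hab]
    exact isNormal_hook_mul_zVec_mul_hooks_of_mem hl hab.symm ha k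
  · have h1 : Commute (zVec (Pi.single b k)) (hooks d l) :=
      zVec_commute_hooks hl fun x hx => Pi.single_eq_of_ne (by rintro rfl; exact hb hx) _
    rw [mul_assoc, h1.eq, ← mul_assoc]
    refine IsNormal.mul_zVec (isNormal_hooks (l := (a, b) :: l) ?_) _
    simp only [ends, List.nodup_cons, List.mem_cons]
    grind

theorem IsNormal.hook_mul (h : IsNormal m) (hab : a ≠ b) : IsNormal (hook d a b * m) := by
  obtain ⟨α, β, l, π, hl, rfl⟩ := h
  -- The part of `α` away from `a` and `b` passes through the hook; the parts at `a` and `b` merge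
  -- into one framing at `b`.
  obtain ⟨α', h1, h2, -, h4⟩ := exists_zVec_split hab α
  have h5 := zVec_commute_hook hab h1 h2
  have h6 : hook d a b * (zVec α * hooks d l * zVec β * permHom d n π) =
      zVec α' * (hook d a b * zVec (Pi.single b (α a + α b)) * hooks d l) * zVec β *
        permHom d n π := by
    rw [zVec_single_add, ← mul_assoc (hook d a b) (zVec _) (zVec _), ← hook_mul_zVec_single hab, h4]
    simp only [← mul_assoc]
    rw [h5.eq]
  rw [h6]
  exact (((isNormal_hook_mul_zVec_mul_hooks hl hab _).zVec_mul _).mul_zVec _).mul_permHom _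

theorem isNormal (m : FramedBrauerMonoid d n) : IsNormal m := by
  have hm : m ∈ Submonoid.closure (Set.range (PresentedMonoid.of (Rel d n))) := by
    rw [PresentedMonoid.closure_range_of]; trivial
  induction hm using Submonoid.closure_induction_left with
  | one => exact isNormal_hooks (l := []) (by simp [ends])
  | mul_left x hx y hy ih =>
    obtain ⟨g, rfl⟩ := hx
    cases g with
    | s i =>
      change IsNormal (genS d n i * y)
      rw [← permHom_swap]
      exact ih.permHom_mul _
    | t i =>
      change IsNormal (genT d n i * y)
      rw [← hook_left_right]
      exact ih.hook_mul (left_ne_right i)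
    | z j =>
      change IsNormal (genZ d n j * y)
      -- For `d = 1` the representative of `1 : ZMod d` is `0`, not `1`, but then `z j = 1`.
      by_cases hd : d = 1
      · subst hd
        have := genZ_pow (d := 1) j
        rw [pow_one] at this
        rwa [this, one_mul]
      · have : Fact (1 < d) := ⟨by have := NeZero.ne d; omega⟩
        have := zVec_single (d := d) j 1
        rw [ZMod.val_one, pow_one] at this
        rw [← this]
        exact ih.zVec_mul _

end FramedNormalForm

/-! ### Labelled matchings and their elementary operations -/

section Diagrams

open Equiv

/-- A perfect matching of `V` whose edges are labelled by `ZMod d`. -/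
@[ext]
structure Diag (V : Type*) (d : ℕ) where
  /-- The point matched with a given point. -/
  mate : V → V
  /-- The label of the edge at a given point. -/
  label : V → ZMod d
  mate_mate : ∀ v, mate (mate v) = v
  mate_ne : ∀ v, mate v ≠ v
  label_mate : ∀ v, label (mate v) = label v

namespace Diag

variable {V : Type*} {d : ℕ}

/-- Renaming the points of a labelled matching. -/
@[simps]
def permute (π : Perm V) (x : Diag V d) : Diag V d where
  mate v := π (x.mate (π.symm v))
  label v := x.label (π.symm v)
  mate_mate v := by simp [x.mate_mate]
  mate_ne v h := x.mate_ne (π.symm v) (by rw [eq_symm_apply, h])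
  label_mate v := by simp [x.label_mate]

theorem permute_one (x : Diag V d) : permute 1 x = x := rfl

theorem permute_mul (x : Diag V d) (π ρ : Perm V) : permute (π * ρ) x = permute π (permute ρ x) := rfl

variable [DecidableEq V]

/-- Adding `k` to the label of the edge at `a`. -/
@[simps]
def addAt (a : V) (k : ZMod d) (x : Diag V d) : Diag V d where
  mate := x.mate
  label v := x.label v + if v = a ∨ v = x.mate a then k else 0
  mate_mate := x.mate_mate
  mate_ne := x.mate_ne
  label_mate v := by
    have := x.mate_mate
    have := x.label_mate
    grind

/-- Joining `a` and `b` by an edge labelled `0`, and their former mates by an edge whose label is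
the sum of the two former labels. -/
@[simps]
def join {a b : V} (h : a ≠ b) (x : Diag V d) : Diag V d where
  -- The order of the tests matters when `a` and `b` are already matched: the first two branches win
  -- and the old label is lost, as required by `t i * z i ^ k * t i = t i`.
  mate v := if v = a then b else if v = b then a else if v = x.mate a then x.mate b
    else if v = x.mate b then x.mate a else x.mate v
  label v := if v = a ∨ v = b then 0 else if v = x.mate a ∨ v = x.mate b
    then x.label a + x.label b else x.label v
  mate_mate v := by
    have := x.mate_mate
    have := x.mate_ne
    grind
  mate_ne v := by
    have := x.mate_mate
    have := x.mate_ne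
    grind
  label_mate v := by
    have := x.mate_mate
    have := x.mate_ne
    have := x.label_mate
    grind

variable (x : Diag V d) {a b c e : V}

theorem permute_addAt (π : Perm V) (k : ZMod d) :
    permute π (addAt a k x) = addAt (π a) k (permute π x) := by
  ext v
  · rfl
  · simp [symm_apply_eq]

theorem permute_join (π : Perm V) (h : a ≠ b) :
    permute π (join h x) = join (π.injective.ne h) (permute π x) := by
  ext v
  · simp only [permute_mate, join_mate, symm_apply_apply, symm_apply_eq]
    grind
  · simp only [permute_label, join_label, symm_apply_apply, symm_apply_eq, permute_mate]

theorem addAt_addAt (k m : ZMod d) : addAt a k (addAt a m x) = addAt a (k + m) x := by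
  ext v
  · rfl
  · simp only [addAt_label, addAt_mate]
    grind

theorem addAt_zero : addAt a 0 x = x := by
  ext v
  · rfl
  · simp

theorem addAt_comm (k m : ZMod d) : addAt a k (addAt b m x) = addAt b m (addAt a k x) := by
  ext v
  · rfl
  · simp only [addAt_label, addAt_mate]
    grind

theorem join_comm (h : a ≠ b) : join h x = join h.symm x := by
  have := x.mate_mate
  ext v
  · simp only [join_mate]
    grind
  · simp only [join_label]
    grind

theorem join_addAt_join (h : a ≠ b) (k : ZMod d) :
    join h (addAt a k (join h x)) = join h x := by
  ext v
  · simp only [join_mate, addAt_mate]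
    grind
  · simp only [join_mate, join_label, addAt_mate, addAt_label]
    grind

theorem join_addAt (h : a ≠ b) (k : ZMod d) : join h (addAt a k x) = join h (addAt b k x) := by
  have := x.mate_mate
  ext v
  · rfl
  · simp only [join_label, addAt_mate, addAt_label]
    grind

theorem addAt_join (h : a ≠ b) (k : ZMod d) : addAt a k (join h x) = addAt b k (join h x) := by
  ext v
  · rfl
  · simp only [join_mate, join_label, addAt_label]
    grind

theorem addAt_join_of_ne (h : a ≠ b) (ha : c ≠ a) (hb : c ≠ b) (k : ZMod d) :
    addAt c k (join h x) = join h (addAt c k x) := by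
  have := x.mate_mate
  have := x.mate_ne
  ext v
  · rfl
  · simp only [join_mate, join_label, addAt_mate, addAt_label]
    grind

theorem permute_swap_join (h : a ≠ b) : permute (swap a b) (join h x) = join h x := by
  have := x.mate_mate
  have := x.mate_ne
  ext v
  · simp only [permute_mate, join_mate, symm_swap, swap_apply_def]
    grind
  · simp only [permute_label, join_label, symm_swap, swap_apply_def]
    grind

theorem join_permute_swap (h : a ≠ b) : join h (permute (swap a b) x) = join h x := by
  have h1 := permute_join x (swap a b) h
  rw [permute_swap_join] at h1
  rw [h1, join_comm]
  simp

theorem join_join (hb : a ≠ b) (hc : a ≠ c) (hbc : b ≠ c) :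
    join hc (join hb x) = permute (swap b c) (join hb x) := by
  have := x.mate_mate
  have := x.mate_ne
  have := x.label_mate
  ext v
  · simp only [permute_mate, join_mate, symm_swap, swap_apply_def]
    grind (splits := 20)
  · simp only [permute_label, join_label, join_mate, symm_swap, swap_apply_def]
    grind (splits := 20)

theorem join_join_comm (h : [a, b, c, e].Nodup) (hab : a ≠ b) (hce : c ≠ e) :
    join hab (join hce x) = join hce (join hab x) := by
  have := x.mate_mate
  have := x.mate_ne
  have := x.label_mate
  simp at h
  ext v
  · simp only [join_mate]
    grind (splits := 20)
  · simp only [join_label, join_mate]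
    grind (splits := 20)

end Diag

end Diagrams

/-! ### The action on labelled matchings -/

section Representation

open Equiv

theorem swap_mul_swap_mul_swap_left {V : Type*} [DecidableEq V] {a b c : V} (hab : a ≠ b)
    (hbc : b ≠ c) (hac : a ≠ c) : swap a b * swap b c * swap a b = swap a c := by
  ext v
  simp only [Perm.mul_apply, swap_apply_def]
  grind

theorem swap_mul_swap_mul_swap_right {V : Type*} [DecidableEq V] {a b c : V} (hab : a ≠ b)
    (hbc : b ≠ c) (hac : a ≠ c) : swap b c * swap a b * swap b c = swap a c := by
  ext v
  simp only [Perm.mul_apply, swap_apply_def]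
  grind

namespace Diag

variable {V : Type*} [DecidableEq V] {d : ℕ} (x : Diag V d) {a b c e : V}

theorem permute_swap_permute_swap : permute (swap a b) (permute (swap a b) x) = x := by
  rw [← permute_mul, swap_mul_self, permute_one]

theorem join_permute_swap_adjacent (hbc : b ≠ c) (hac : a ≠ c) :
    join hbc (permute (swap a b) x) = permute (swap a b) (join hac x) := by
  rw [permute_join]
  simp [swap_apply_of_ne_of_ne hac.symm hbc.symm]

theorem permute_swap_join_of_nodup (hce : c ≠ e) (h : [a, b, c, e].Nodup) :
    permute (swap a b) (join hce x) = join hce (permute (swap a b) x) := by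
  have h1 : c ≠ a ∧ c ≠ b ∧ e ≠ a ∧ e ≠ b := by simp at h; grind
  rw [permute_join]
  simp [swap_apply_of_ne_of_ne h1.1 h1.2.1, swap_apply_of_ne_of_ne h1.2.2.1 h1.2.2.2]

/-- The Brauer relations on three points are all derived from `join_join` and the absorption of
transpositions, so the case analysis on points is done only once. -/
theorem permute_swap_join_join (hab : a ≠ b) (hbc : b ≠ c) (hac : a ≠ c) :
    permute (swap a b) (join hbc (join hab x)) = permute (swap b c) (join hab x) := by
  rw [join_comm x hab, join_join x hab.symm hbc hac, ← join_comm x hab]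
  conv_lhs => rw [← permute_swap_join x hab]
  rw [← permute_mul, ← permute_mul, ← swap_mul_swap_mul_swap_left hab hbc hac, ← mul_assoc,
    ← mul_assoc, swap_mul_self, one_mul, mul_assoc, swap_mul_self, mul_one]

theorem join_join_join (hab : a ≠ b) (hbc : b ≠ c) (hac : a ≠ c) :
    join hab (join hbc (join hab x)) = join hab x := by
  have h1 := join_join x hab.symm hbc hac
  rw [join_comm x hab, h1, ← join_comm x hab, swap_comm a c,
    join_permute_swap_adjacent _ hab hbc.symm, join_comm _ hbc.symm, join_comm x hab, h1, swap_comm c a, permute_swap_permute_swap]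

theorem join_join_permute_swap (hab : a ≠ b) (hbc : b ≠ c) (hac : a ≠ c) :
    join hab (join hbc (permute (swap a b) x)) = join hab (permute (swap b c) x) := by
  rw [join_permute_swap_adjacent _ hbc hac, join_permute_swap, join_join _ hac hab hbc.symm,
    swap_comm b c, join_comm _ hab, join_comm _ hac,
    ← join_permute_swap_adjacent _ hab.symm hac.symm]

end Diag

open Diag

variable {d n : ℕ}

theorem inl_left_ne_inl_right (i : Fin (n - 1)) :
    (Sum.inl (left i) : Fin n ⊕ Fin n) ≠ Sum.inl (right i) :=
  Sum.inl_injective.ne (left_ne_right i)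

variable (d n) in
/-- The operators on labelled matchings by which the generators act. -/
def genAct : FramedBrauerGen n → Function.End (Diag (Fin n ⊕ Fin n) d)
  | .s i => permute (swap (Sum.inl (left i)) (Sum.inl (right i)))
  | .t i => join (inl_left_ne_inl_right i)
  | .z j => addAt (Sum.inl j) 1

variable (x : Diag (Fin n ⊕ Fin n) d)

theorem lift_genAct_s (i : Fin (n - 1)) : FreeMonoid.lift (genAct d n) (s i) x =
    permute (swap (Sum.inl (left i)) (Sum.inl (right i))) x := rfl

theorem lift_genAct_t (i : Fin (n - 1)) : FreeMonoid.lift (genAct d n) (t i) x =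
    join (inl_left_ne_inl_right i) x := rfl

theorem lift_genAct_z (j : Fin n) : FreeMonoid.lift (genAct d n) (z j) x =
    addAt (Sum.inl j) 1 x := rfl

theorem end_mul_apply {α : Type*} (f g : Function.End α) (x : α) : (f * g) x = f (g x) := rfl

theorem end_one_apply {α : Type*} (x : α) : (1 : Function.End α) x = x := rfl

theorem lift_genAct_z_pow (j : Fin n) (k : ℕ) : (FreeMonoid.lift (genAct d n) (z j) ^ k) x =
    addAt (Sum.inl j) (k : ZMod d) x := by
  induction k with
  | zero => rw [pow_zero, Nat.cast_zero, addAt_zero, end_one_apply]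
  | succ k ih =>
    rw [pow_succ', end_mul_apply, ih, lift_genAct_z, addAt_addAt, Nat.cast_succ, add_comm]

/-- Naming the shared point `b` treats `j = i + 1` and `j = i - 1` alike; joins and transpositions
do not depend on the order of their ends. -/
theorem Near.exists_triple {i j : Fin (n - 1)} (h : Near i j) :
    ∃ (a b c : Fin n ⊕ Fin n) (hab : a ≠ b) (hbc : b ≠ c), a ≠ c ∧
      swap (Sum.inl (left i)) (Sum.inl (right i)) = swap a b ∧
      swap (Sum.inl (left j)) (Sum.inl (right j)) = swap b c ∧
      (∀ x : Diag (Fin n ⊕ Fin n) d, join (inl_left_ne_inl_right i) x = join hab x) ∧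
      ∀ x : Diag (Fin n ⊕ Fin n) d, join (inl_left_ne_inl_right j) x = join hbc x := by
  rcases h with h | h
  · have e : right i = left j := Fin.ext h
    refine ⟨_, _, Sum.inl (right j), inl_left_ne_inl_right i, ?_, ?_, rfl, ?_, fun x => rfl, ?_⟩
    · rw [e]; exact inl_left_ne_inl_right j
    · simp [left, right, Fin.ext_iff]; omega
    · rw [e]
    · simp only [e, implies_true]
  · have e : right j = left i := Fin.ext h
    refine ⟨_, _, Sum.inl (left j), (inl_left_ne_inl_right i).symm, ?_, ?_, swap_comm _ _, ?_,
      fun x => join_comm x _, fun x => ?_⟩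
    · rw [← e]; exact (inl_left_ne_inl_right j).symm
    · simp [left, right, Fin.ext_iff]; omega
    · rw [e, swap_comm]
    · rw [join_comm]; simp only [e]

theorem Far.nodup {i j : Fin (n - 1)} (h : Far i j) :
    [(Sum.inl (left i) : Fin n ⊕ Fin n), Sum.inl (right i), Sum.inl (left j),
      Sum.inl (right j)].Nodup := by
  rcases h with h | h <;> simp [left, right, Fin.ext_iff] <;> omega

theorem lift_genAct_eq {u v : FreeMonoid (FramedBrauerGen n)} (h : Rel d n u v) :
    FreeMonoid.lift (genAct d n) u = FreeMonoid.lift (genAct d n) v := by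
  funext x
  cases h with
  | z_pow j =>
    rw [map_pow, lift_genAct_z_pow, map_one, ZMod.natCast_self, addAt_zero, end_one_apply]
  | t_z_t i k =>
    simp only [map_mul, map_pow, end_mul_apply, lift_genAct_z_pow, lift_genAct_t, join_addAt_join]
  | s_comm i j h =>
    have h1 := h.nodup
    simp only [map_mul, end_mul_apply, lift_genAct_s, ← permute_mul]
    congr 1
    ext v
    simp only [Perm.mul_apply, swap_apply_def]
    generalize (Sum.inl (left i) : Fin n ⊕ Fin n) = a at *
    generalize (Sum.inl (right i) : Fin n ⊕ Fin n) = b at *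
    generalize (Sum.inl (left j) : Fin n ⊕ Fin n) = a at *
    generalize (Sum.inl (right j) : Fin n ⊕ Fin n) = b at *
    simp at h1
    grind
  | s_braid i j h =>
    obtain ⟨a, b, c, hab, hbc, hac, e1, e2, e3, e4⟩ := h.exists_triple (d := d)
    simp only [map_mul, end_mul_apply, lift_genAct_s, e1, e2, ← permute_mul]
    rw [← mul_assoc, ← mul_assoc, swap_mul_swap_mul_swap_left hab hbc hac, swap_mul_swap_mul_swap_right hab hbc hac]
  | z_s i j =>
    simp only [map_mul, end_mul_apply, lift_genAct_s, lift_genAct_z]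
    rw [permute_addAt, ← Sum.inl_injective.swap_apply, swap_apply_self]
  | t_t_t i j h =>
    obtain ⟨a, b, c, hab, hbc, hac, e1, e2, e3, e4⟩ := h.exists_triple (d := d)
    simp only [map_mul, end_mul_apply, lift_genAct_t, e3, e4]
    exact join_join_join x hab hbc hac
  | s_t_t i j h =>
    obtain ⟨a, b, c, hab, hbc, hac, e1, e2, e3, e4⟩ := h.exists_triple (d := d)
    simp only [map_mul, end_mul_apply, lift_genAct_t, lift_genAct_s, e1, e2, e3, e4]
    exact permute_swap_join_join x hab hbc hac
  | t_t_s i j h =>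
    obtain ⟨a, b, c, hab, hbc, hac, e1, e2, e3, e4⟩ := h.exists_triple (d := d)
    simp only [map_mul, end_mul_apply, lift_genAct_t, lift_genAct_s, e1, e2, e3, e4]
    exact join_join_permute_swap x hab hbc hac
  | t_s_comm i j h =>
    simp only [map_mul, end_mul_apply, lift_genAct_t, lift_genAct_s]
    exact (permute_swap_join_of_nodup x _ (Far.nodup h.symm)).symm
  | z_t_comm i j hl hr =>
    simp only [map_mul, end_mul_apply, lift_genAct_t, lift_genAct_z]
    exact addAt_join_of_ne x _ (Sum.inl_injective.ne hl) (Sum.inl_injective.ne hr) _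
  | t_idem i =>
    have := join_addAt_join x (inl_left_ne_inl_right i) 0
    rw [addAt_zero] at this
    simpa only [map_mul, end_mul_apply, lift_genAct_t] using this
  | z_comm | s_sq | t_comm | t_z | z_t | t_s | s_t =>
    simp only [map_mul, map_one, end_mul_apply, end_one_apply, lift_genAct_s, lift_genAct_t,
      lift_genAct_z]
    first
      | exact addAt_comm x _ _
      | exact permute_swap_permute_swap x
      | exact join_addAt x _ _
      | exact addAt_join x _ _
      | exact permute_swap_join x _
      | exact join_permute_swap x _
      | exact join_join_comm x (Far.nodup ‹_›) _ _

variable (d n) in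
/-- The action of the framed Brauer monoid on labelled matchings. -/
def rep : FramedBrauerMonoid d n →* Function.End (Diag (Fin n ⊕ Fin n) d) :=
  PresentedMonoid.lift (genAct d n) fun _ _ => lift_genAct_eq

theorem rep_genS (i : Fin (n - 1)) : rep d n (genS d n i) x =
    permute (swap (Sum.inl (left i)) (Sum.inl (right i))) x := rfl

theorem rep_genT (i : Fin (n - 1)) : rep d n (genT d n i) x =
    join (inl_left_ne_inl_right i) x := rfl

theorem rep_mul (m m' : FramedBrauerMonoid d n) : rep d n (m * m') x = rep d n m (rep d n m' x) := by
  rw [map_mul, end_mul_apply]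

theorem rep_one : rep d n 1 x = x := by rw [map_one, end_one_apply]

theorem rep_permHom (π : Perm (Fin n)) :
    rep d n (permHom d n π) x = permute (Perm.sumCongr π (1 : Perm (Fin n))) x := by
  have : π ∈ Submonoid.closure (Set.range fun i : Fin (n - 1) => swap (left i) (right i)) := by
    rw [closure_swap_left_right]; trivial
  induction this using Submonoid.closure_induction generalizing x with
  | mem x hx =>
    obtain ⟨i, rfl⟩ := hx
    simp only [permHom_swap, rep_genS, Perm.sumCongr_swap_one]
  | one => rw [map_one, rep_one, Perm.sumCongr_one, permute_one]
  | mul π ρ _ _ h1 h2 =>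
    rw [map_mul, rep_mul, h2, h1, ← permute_mul, Perm.sumCongr_mul, one_mul]

theorem rep_hook {a b : Fin n} (h : a ≠ b) :
    rep d n (hook d a b) x = join (Sum.inl_injective.ne h) x := by
  obtain ⟨i, π, rfl, rfl⟩ := exists_perm_pair h
  have h1 : hook d (π (left i)) (π (right i)) =
      permHom d n π * genT d n i * permHom d n π⁻¹ := by
    apply permHom_right_cancel π
    rw [← permHom_mul_hook _ (left_ne_right i), mul_assoc _ (permHom d n π⁻¹), ← map_mul,
      inv_mul_cancel, map_one, mul_one, hook_left_right]
  rw [h1, rep_mul, rep_mul, rep_permHom, rep_permHom, rep_genT, permute_join, ← permute_mul,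
    Perm.sumCongr_mul, mul_inv_cancel, one_mul, Perm.sumCongr_one, permute_one]
  simp

theorem rep_genZ_pow (j : Fin n) (k : ℕ) :
    rep d n (genZ d n j ^ k) x = addAt (Sum.inl j) (k : ZMod d) x := by
  rw [map_pow]
  exact lift_genAct_z_pow x j k

variable [NeZero d] (α : Fin n → ZMod d)

theorem rep_zVec_mate (v : Fin n ⊕ Fin n) : (rep d n (zVec α) x).mate v = x.mate v := by
  refine zVec_induction (P := fun α => ∀ x v, (rep d n (zVec α) x).mate v = x.mate v) α
    (fun x v => ?_) (fun α β h1 h2 x v => ?_) (fun j x v => ?_) x v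
  · rw [zVec_zero, rep_one]
  · rw [zVec_add, rep_mul, h1, h2]
  · rw [zVec_single, rep_genZ_pow, addAt_mate]

/-- An edge collects `α` at each of its top ends, and bottom ends contribute `0`. -/
theorem rep_zVec_label (v : Fin n ⊕ Fin n) : (rep d n (zVec α) x).label v =
    x.label v + Sum.elim α 0 v + Sum.elim α 0 (x.mate v) := by
  refine zVec_induction (P := fun α => ∀ x v, (rep d n (zVec α) x).label v =
    x.label v + Sum.elim α 0 v + Sum.elim α 0 (x.mate v)) α
    (fun x v => ?_) (fun α β h1 h2 x v => ?_) (fun j x v => ?_) x v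
  · rw [zVec_zero, rep_one]
    cases v <;> cases x.mate _ <;> simp
  · rw [zVec_add, rep_mul, h1, h2, rep_zVec_mate]
    have h3 : ∀ w, Sum.elim (α + β) (0 : Fin n → ZMod d) w = Sum.elim α 0 w + Sum.elim β 0 w := by
      intro w; cases w <;> simp
    rw [h3, h3]
    ring
  · rw [zVec_single, rep_genZ_pow, addAt_label, ZMod.natCast_zmod_val]
    have h3 : ∀ w, Sum.elim (Pi.single j (α j)) (0 : Fin n → ZMod d) w =
        if w = Sum.inl j then α j else 0 := by
      intro w; cases w <;> simp [Pi.single_apply]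
    have := x.mate_mate
    have := x.mate_ne
    rw [h3, h3]
    grind

end Representation

/-! ### The orbit of the identity matching -/

section Faithful

open Equiv Diag

variable {d n : ℕ}

variable (d n) in
/-- The identity matching, with all labels `0`. -/
def idDiag : Diag (Fin n ⊕ Fin n) d where
  mate := Sum.swap
  label _ := 0
  mate_mate := Sum.swap_swap
  mate_ne v := by cases v <;> simp
  label_mate _ := rfl

/-- Clearing the label of `{a, b}` and exchanging `b` with `c` gives edges `{a, c}` and `{b, e}`.
Joining `a` to `b` closes up `{c, e}` with its own label, and the label of `{a, b}` is then
restored. -/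
theorem addAt_join_permute_addAt {V : Type*} [DecidableEq V] (x : Diag V d) {a b c e : V}
    (hab : x.mate a = b) (hce : x.mate c = e) (hac : a ≠ c) (hae : a ≠ e) (h : a ≠ b) :
    addAt a (x.label a) (join h (permute (swap b c) (addAt a (-x.label a) x))) = x := by
  have hx := x.mate_mate
  have hlab := x.label_mate
  have hba : x.mate b = a := by rw [← hab, hx]
  have hec : x.mate e = c := by rw [← hce, hx]
  have hne := x.mate_ne
  have hce' : c ≠ e := by have := hne c; grind
  have hbc : b ≠ c := by grind
  have h1 : swap b c a = a := swap_apply_of_ne_of_ne h hac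
  ext v
  · simp only [addAt_mate, join_mate, permute_mate, symm_swap, h1, hab, swap_apply_left, hce]
    simp only [swap_apply_def]
    grind (splits := 20)
  · simp only [addAt_mate, join_mate, permute_mate, symm_swap, h1, hab, swap_apply_left, hce, join_label, permute_label, addAt_label]
    simp only [swap_apply_def]
    grind (splits := 20)

/-- Each arc cuts two through edges, leaving a top edge labelled `0` and a bottom edge that carries
the sum of their labels. -/
theorem rep_hooks {l : List (Fin n × Fin n)} (hl : (ends l).Nodup) (β : Fin n → ZMod d)
    (ρ : Fin n → Fin n) (hρ : Function.Injective ρ) (x : Diag (Fin n ⊕ Fin n) d)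
    (h1 : ∀ a, x.mate (Sum.inl a) = Sum.inr (ρ a)) (h2 : ∀ a, x.label (Sum.inl a) = β a) :
    (∀ a, a ∉ ends l → (rep d n (hooks d l) x).mate (Sum.inl a) = Sum.inr (ρ a) ∧
      (rep d n (hooks d l) x).label (Sum.inl a) = β a) ∧
    ∀ a b, IsArc l a b → (rep d n (hooks d l) x).mate (Sum.inl a) = Sum.inl b ∧
      (rep d n (hooks d l) x).label (Sum.inl a) = 0 ∧
      (rep d n (hooks d l) x).mate (Sum.inr (ρ a)) = Sum.inr (ρ b) ∧
      (rep d n (hooks d l) x).label (Sum.inr (ρ a)) = β a + β b := by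
  induction l with
  | nil =>
    refine ⟨fun a _ => ?_, fun a b h => (not_isArc_nil h).elim⟩
    rw [hooks, rep_one]
    exact ⟨h1 a, h2 a⟩
  | cons p l ih =>
    obtain ⟨a, b⟩ := p
    simp only [ends, List.nodup_cons, List.mem_cons, not_or] at hl
    obtain ⟨ih1, ih2⟩ := ih hl.2.2
    simp only [hooks, rep_mul, rep_hook _ hl.1.1, ends, List.mem_cons, not_or, isArc_cons,
      join_mate, join_label]
    generalize rep d n (hooks d l) x = y at *
    obtain ⟨a1, a2⟩ := ih1 a hl.1.2
    obtain ⟨b1, b2⟩ := ih1 b hl.2.1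
    rw [a1, a2, b1, b2]
    have hm : ∀ x y, IsArc l x y → x ∈ ends l := fun x y => mem_ends_of_isArc
    refine ⟨fun c hc => ?_, fun c e hce => ?_⟩
    · obtain ⟨c1, c2⟩ := ih1 c hc.2.2
      simp [c1, c2, hc.1, hc.2.1]
    · rcases hce with h | h | h
      · obtain ⟨rfl, rfl⟩ := Prod.mk.inj h
        simp
      · obtain ⟨rfl, rfl⟩ := Prod.mk.inj h
        have := hl.1.1
        have := Ne.symm this
        simp_all [add_comm, hρ.eq_iff]
      · have hc : c ≠ a ∧ c ≠ b := by have := hm c e h; grind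
        obtain ⟨c1, c2, c3, c4⟩ := ih2 c e h
        simp [c1, c2, c3, c4, hc.1, hc.2, hρ.eq_iff]

variable [NeZero d]

/-- The matching obtained from the product of `z^β` and a permutation. -/
theorem rep_zVec_permHom (β : Fin n → ZMod d) (π : Perm (Fin n)) (a : Fin n) :
    (rep d n (zVec β * permHom d n π) (idDiag d n)).mate (Sum.inl a) = Sum.inr (π.symm a) ∧
    (rep d n (zVec β * permHom d n π) (idDiag d n)).label (Sum.inl a) = β a := by
  rw [rep_mul, rep_zVec_mate, rep_zVec_label, rep_permHom]
  simp [idDiag, Perm.sumCongr]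

/-- The matching described by a normal form. -/
theorem rep_normalForm {l : List (Fin n × Fin n)} (hl : (ends l).Nodup) (α β : Fin n → ZMod d)
    (π : Perm (Fin n)) (x : Diag (Fin n ⊕ Fin n) d)
    (hx : rep d n (zVec α * hooks d l * zVec β * permHom d n π) (idDiag d n) = x) :
    (∀ a, a ∉ ends l → x.mate (Sum.inl a) = Sum.inr (π.symm a) ∧
      x.label (Sum.inl a) = α a + β a) ∧
    ∀ a b, IsArc l a b → x.mate (Sum.inl a) = Sum.inl b ∧ x.label (Sum.inl a) = α a + α b ∧
      x.mate (Sum.inr (π.symm a)) = Sum.inr (π.symm b) ∧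
      x.label (Sum.inr (π.symm a)) = β a + β b := by
  subst hx
  obtain ⟨h1, h2⟩ := rep_hooks hl β π.symm π.symm.injective _
    (fun a => (rep_zVec_permHom β π a).1) (fun a => (rep_zVec_permHom β π a).2)
  simp only [mul_assoc, rep_mul _ (zVec α), rep_zVec_mate, rep_zVec_label]
  rw [rep_mul]
  generalize rep d n (hooks d l) _ = y at *
  refine ⟨fun a ha => ?_, fun a b hab => ?_⟩
  · obtain ⟨i1, i2⟩ := h1 a ha
    simp [i1, i2, add_comm]
  · obtain ⟨i1, i2, i3, i4⟩ := h2 a b hab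
    simp [i1, i2, i3, i4]

theorem rep_idDiag_injective :
    Function.Injective fun m : FramedBrauerMonoid d n => rep d n m (idDiag d n) := by
  intro m m' h
  obtain ⟨α, β, l, π, hl, rfl⟩ := isNormal m
  obtain ⟨α', β', l', π', hl', rfl⟩ := isNormal m'
  beta_reduce at h
  generalize hx : rep d n (zVec α * hooks d l * zVec β * permHom d n π) (idDiag d n) = x at h
  obtain ⟨h1, h2⟩ := rep_normalForm hl α β π x hx
  obtain ⟨h1', h2'⟩ := rep_normalForm hl' α' β' π' x h.symm
  clear h hx
  have hmem : ∀ a, a ∈ ends l → a ∈ ends l' := by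
    intro a ha
    obtain ⟨b, hb⟩ := exists_isArc_of_mem_ends ha
    by_contra hc
    have := (h2 a b hb).1
    rw [(h1' a hc).1] at this
    exact Sum.inr_ne_inl this
  have hmem' : ∀ a, a ∈ ends l' → a ∈ ends l := by
    intro a ha
    obtain ⟨b, hb⟩ := exists_isArc_of_mem_ends ha
    by_contra hc
    have := (h2' a b hb).1
    rw [(h1 a hc).1] at this
    exact Sum.inr_ne_inl this
  -- The top edges of the common matching are exactly the arcs of each normal form.
  have harc : ∀ a b, IsArc l a b ↔ IsArc l' a b := by
    refine fun a b => ⟨fun hab => ?_, fun hab => ?_⟩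
    · obtain ⟨c, hc⟩ := exists_isArc_of_mem_ends (hmem a (mem_ends_of_isArc hab))
      have := (h2 a b hab).1.symm.trans (h2' a c hc).1
      rwa [Sum.inl_injective this]
    · obtain ⟨c, hc⟩ := exists_isArc_of_mem_ends (hmem' a (mem_ends_of_isArc hab))
      have := (h2' a b hab).1.symm.trans (h2 a c hc).1
      rwa [Sum.inl_injective this]
  rw [← hooks_eq_of_isArc_iff (d := d) hl hl' harc]
  simp only [← harc] at h2'
  have hfix : ∀ a, a ∉ ends l → (π' * π⁻¹) a = a := by
    intro a ha
    have h3 := (h1 a ha).1.symm.trans (h1' a fun h => ha (hmem' a h)).1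
    rw [Perm.mul_apply, Perm.inv_def, Sum.inr_injective h3, apply_symm_apply]
  have hsymm : ∀ a, π'.symm ((π' * π⁻¹) a) = π.symm a := by
    intro a
    rw [Perm.mul_apply, Perm.inv_def, symm_apply_apply]
  -- The bottom edges show that `π' * π⁻¹` preserves the arcs, and `hfix` that it is trivial off
  -- them. Hence the hooks absorb it.
  have hσ : ∀ a b, IsArc l a b → IsArc l ((π' * π⁻¹) a) ((π' * π⁻¹) b) ∧
      β a + β b = β' ((π' * π⁻¹) a) + β' ((π' * π⁻¹) b) := by
    intro a b hab
    obtain ⟨-, -, i1, i2⟩ := h2 a b hab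
    have hc : (π' * π⁻¹) a ∈ ends l := by
      by_contra hc
      have h3 := (h1' _ fun h => hc (hmem' _ h)).1
      rw [hsymm] at h3
      rw [← h3, x.mate_mate] at i1
      exact Sum.inl_ne_inr i1
    obtain ⟨c, hc⟩ := exists_isArc_of_mem_ends hc
    obtain ⟨-, -, i3, i4⟩ := h2' _ _ hc
    rw [hsymm] at i3 i4
    have h4 := Sum.inr_injective (i1.symm.trans i3)
    obtain rfl : (π' * π⁻¹) b = c := by rw [← π'.symm.injective.eq_iff, ← h4, hsymm]
    exact ⟨hc, i2.symm.trans i4⟩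
  have hπ : π' = (π' * π⁻¹) * π := by group
  have habs := hooks_mul_permHom (d := d) hl (fun a b h => (hσ a b h).1) hfix
  generalize π' * π⁻¹ = σ at *
  have hz : zVec (α' - α) * hooks d l * zVec (β' ∘ σ - β) = hooks d l := by
    refine zVec_mul_hooks_mul_zVec hl (fun a b hab => ?_) (fun a b hab => ?_) fun a ha => ?_
    · have := (h2 a b hab).2.1.symm.trans (h2' a b hab).2.1
      simp only [Pi.sub_apply]
      linear_combination -this
    · have := (hσ a b hab).2
      simp only [Pi.sub_apply, Function.comp_apply]
      linear_combination -this
    · have := (h1 a ha).2.symm.trans (h1' a fun h => ha (hmem' a h)).2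
      simp only [Pi.sub_apply, Function.comp_apply, hfix a ha]
      linear_combination -this
  have hβ : zVec β' * permHom d n σ = permHom d n σ * zVec (β' ∘ σ) := by
    rw [permHom_mul_zVec, Function.comp_assoc, self_comp_symm, Function.comp_id]
  have hα' : α' = α + (α' - α) := by abel
  have hβ' : β' ∘ σ = (β' ∘ σ - β) + β := by abel
  symm
  calc zVec α' * hooks d l * zVec β' * permHom d n π'
      = zVec α' * hooks d l * (zVec β' * permHom d n σ) * permHom d n π := by
        rw [hπ, map_mul]; simp only [mul_assoc]
    _ = zVec α' * (hooks d l * permHom d n σ) * zVec (β' ∘ σ) * permHom d n π := by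
        rw [hβ]; simp only [mul_assoc]
    _ = zVec α * (zVec (α' - α) * hooks d l * zVec (β' ∘ σ - β)) * zVec β * permHom d n π := by
        rw [habs, hα', hβ', zVec_add, zVec_add]
        simp only [mul_assoc, add_sub_cancel_left, add_sub_cancel_right]
    _ = zVec α * hooks d l * zVec β * permHom d n π := by rw [hz]

theorem rep_idDiag_surjective :
    Function.Surjective fun m : FramedBrauerMonoid d n => rep d n m (idDiag d n) := by
  intro x
  induction hk : (Finset.univ.filter fun a : Fin n => (x.mate (Sum.inl a)).isLeft).card
    using Nat.strong_induction_on generalizing x with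
  | _ k ih =>
  subst hk
  have hx := x.mate_mate
  have hne := x.mate_ne
  have hlab := x.label_mate
  by_cases h : ∃ a b, x.mate (Sum.inl a) = Sum.inl b
  · obtain ⟨a, b, hab⟩ := h
    -- Otherwise all bottom points are matched to the top injectively, hence onto, leaving no top
    -- point free to be matched with `a`.
    obtain ⟨c, e, hce⟩ : ∃ c e, x.mate (Sum.inr c) = Sum.inr e := by
      by_contra! hc
      have h1 : ∀ c, ∃ e, x.mate (Sum.inr c) = Sum.inl e := by
        intro c
        rcases h2 : x.mate (Sum.inr c) with e | e
        · exact ⟨e, rfl⟩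
        · exact (hc c e h2).elim
      choose f hf using h1
      have hinj : Function.Injective f := by
        intro c c' hcc
        have := congrArg x.mate ((hf c).trans ((congrArg Sum.inl hcc).trans (hf c').symm))
        rw [hx, hx] at this
        exact Sum.inr_injective this
      obtain ⟨c, hc⟩ := Finite.injective_iff_surjective.1 hinj a
      have := hf c
      rw [hc] at this
      have := congrArg x.mate this
      rw [hx, hab] at this
      exact Sum.inr_ne_inl this
    have hne' : a ≠ b := by rintro rfl; exact hne _ hab
    let y := permute (swap (Sum.inl b) (Sum.inr c)) (addAt (Sum.inl a) (-x.label (Sum.inl a)) x)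
    have hlt : (Finset.univ.filter fun v : Fin n => (y.mate (Sum.inl v)).isLeft).card <
        (Finset.univ.filter fun v : Fin n => (x.mate (Sum.inl v)).isLeft).card := by
      refine Finset.card_lt_card ((Finset.ssubset_iff_of_subset ?_).2 ⟨a, ?_, ?_⟩)
      · intro v hv
        simp only [Finset.mem_filter, Finset.mem_univ, true_and, y, permute_mate, addAt_mate,
          symm_swap, swap_apply_def] at hv ⊢
        grind
      · simp [hab]
      · simp [y, hab, swap_apply_of_ne_of_ne, hne']
    obtain ⟨m, hm⟩ := ih _ hlt y rfl
    refine ⟨zVec (Pi.single a (x.label (Sum.inl a))) * hook d a b * m, ?_⟩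
    beta_reduce at hm ⊢
    rw [rep_mul, rep_mul, hm, rep_hook _ hne', zVec_single, rep_genZ_pow, ZMod.natCast_zmod_val]
    exact addAt_join_permute_addAt x hab hce Sum.inl_ne_inr Sum.inl_ne_inr _
  · push Not at h
    have h1 : ∀ c, ∃ e, x.mate (Sum.inl c) = Sum.inr e := by
      intro c
      rcases h2 : x.mate (Sum.inl c) with e | e
      · exact (h c e h2).elim
      · exact ⟨e, rfl⟩
    choose f hf using h1
    have hinj : Function.Injective f := by
      intro c c' hcc
      have := congrArg x.mate ((hf c).trans ((congrArg Sum.inr hcc).trans (hf c').symm))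
      rw [hx, hx] at this
      exact Sum.inl_injective this
    let ρ : Perm (Fin n) := ofBijective f (Finite.injective_iff_bijective.1 hinj)
    have hρ : ∀ a, ρ a = f a := fun _ => rfl
    -- The inverse appears because `π` matches the top point `a` with the bottom point `π.symm a`.
    refine ⟨zVec (fun a => x.label (Sum.inl a)) * permHom d n ρ⁻¹, ?_⟩
    beta_reduce
    generalize hy : rep d n _ (idDiag d n) = y
    have h2 : ∀ a, y.mate (Sum.inl a) = Sum.inr (f a) ∧ y.label (Sum.inl a) = x.label (Sum.inl a) := by
      intro a
      rw [← hy]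
      exact rep_zVec_permHom _ ρ⁻¹ a
    have h3 : ∀ v, y.mate v = x.mate v ∧ y.label v = x.label v := by
      rintro (a | c)
      · rw [(h2 a).1, (h2 a).2, hf]; exact ⟨rfl, rfl⟩
      · obtain ⟨a, rfl⟩ := ρ.surjective c
        rw [hρ]
        constructor
        · rw [← (h2 a).1, y.mate_mate, (h2 a).1, ← hf, hx]
        · rw [← (h2 a).1, y.label_mate, (h2 a).1, ← hf, hlab, (h2 a).2]
    exact Diag.ext (funext fun v => (h3 v).1) (funext fun v => (h3 v).2)

end Faithful

/-! ### Counting labelled matchings -/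

section Counting

open Equiv

namespace Diag

variable {V : Type*} {d : ℕ}

instance [Finite V] [NeZero d] : Finite (Diag V d) :=
  Finite.of_injective (fun x : Diag V d => (x.mate, x.label)) fun _ _ h =>
    Diag.ext (Prod.mk.inj h).1 (Prod.mk.inj h).2

instance [IsEmpty V] : Unique (Diag V d) where
  default := ⟨isEmptyElim, isEmptyElim, isEmptyElim, isEmptyElim, isEmptyElim⟩
  uniq _ := Diag.ext (Subsingleton.elim _ _) (Subsingleton.elim _ _)

variable [DecidableEq V]

/-- Adding an edge between two new points to a labelled matching. -/
@[simps]
def extend {a b : V} (h : a ≠ b) (k : ZMod d) (y : Diag {v // v ≠ a ∧ v ≠ b} d) : Diag V d where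
  mate v := if ha : v = a then b else if hb : v = b then a else y.mate ⟨v, ha, hb⟩
  label v := if ha : v = a then k else if hb : v = b then k else y.label ⟨v, ha, hb⟩
  mate_mate v := by
    have h1 := y.mate_mate
    split_ifs with i1 i2 <;> grind
  mate_ne v := by
    have h1 := y.mate_ne
    split_ifs with i1 i2 <;> grind
  label_mate v := by
    have h1 := y.label_mate
    split_ifs with i1 i2 <;> grind

/-- The labelled matchings with an edge from `a` to `b`. -/
def mateEquiv {a b : V} (h : a ≠ b) :
    {x : Diag V d // x.mate a = b} ≃ ZMod d × Diag {v // v ≠ a ∧ v ≠ b} d where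
  toFun x := ⟨x.1.label a,
    { mate := fun v => ⟨x.1.mate v, by
        have h1 := x.1.mate_mate
        have h2 := x.2
        have h3 := v.2
        grind⟩
      label := fun v => x.1.label v
      mate_mate := fun v => Subtype.ext (x.1.mate_mate v)
      mate_ne := fun v e => x.1.mate_ne v (congrArg Subtype.val e)
      label_mate := fun v => x.1.label_mate v }⟩
  invFun p := ⟨extend h p.1 p.2, by simp⟩
  left_inv x := by
    have h1 := x.1.mate_mate
    have h2 := x.2
    have h3 := x.1.label_mate
    refine Subtype.ext (Diag.ext (funext fun v => ?_) (funext fun v => ?_))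
    · simp only [extend_mate]
      grind
    · simp only [extend_label]
      grind
  right_inv p := by
    refine Prod.ext (by simp) (Diag.ext (funext fun v => ?_) (funext fun v => ?_))
    · simp [v.2.1, v.2.2]
    · simp [v.2.1, v.2.2]

end Diag

/-- Sort the matchings by the mate of a fixed point `a`: the fibre over `a` is empty, and each of
the other `2k + 1` fibres is a label times a matching of the remaining points. For `k = 0` the
truncated `2 * k - 1` is `0`, and `0‼ = 1` agrees with `(-1)!! = 1`. -/
theorem card_diag {d : ℕ} [NeZero d] (k : ℕ) (V : Type) [Fintype V] [DecidableEq V]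
    (hV : Fintype.card V = 2 * k) :
    Nat.card (Diag V d) = d ^ k * Nat.doubleFactorial (2 * k - 1) := by
  induction k generalizing V with
  | zero =>
    have : IsEmpty V := Fintype.card_eq_zero_iff.1 hV
    simp
  | succ k ih =>
    obtain ⟨a⟩ : Nonempty V := Fintype.card_pos_iff.1 (by omega)
    have h1 : ∀ b, b ≠ a → Nat.card {x : Diag V d // x.mate a = b} =
        d * (d ^ k * Nat.doubleFactorial (2 * k - 1)) := by
      intro b hb
      rw [Nat.card_congr (Diag.mateEquiv hb.symm), Nat.card_prod, Nat.card_zmod, ih]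
      have h2 : ({v | v ≠ a ∧ v ≠ b} : Finset V) = (Finset.univ.erase b).erase a := by
        ext v; simp
      rw [Fintype.card_subtype, h2, Finset.card_erase_of_mem (by simp [hb.symm]),
        Finset.card_erase_of_mem (by simp), Finset.card_univ, hV]
      omega
    have h2 : Nat.card {x : Diag V d // x.mate a = a} = 0 := by
      rw [Nat.card_eq_zero]
      exact Or.inl ⟨fun x => x.1.mate_ne a x.2⟩
    rw [← Nat.card_congr (sigmaFiberEquiv fun x : Diag V d => x.mate a), Nat.card_sigma,
      ← Finset.add_sum_erase _ _ (Finset.mem_univ a), h2, zero_add,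
      Finset.sum_congr rfl fun b hb => h1 b (Finset.ne_of_mem_erase hb), Finset.sum_const,
      Finset.card_erase_of_mem (Finset.mem_univ a), Finset.card_univ, hV,
      show 2 * (k + 1) - 1 = 2 * k + 1 by omega, Nat.doubleFactorial_add_one, smul_eq_mul]
    ring

end Counting

end FramedBrauer

/-- Finiteness is included: `Nat.card` of an infinite type is `0`, while the right-hand side is
positive for `d ≥ 1`. -/
theorem mainTheorem2 (d n : ℕ) (hd : 1 ≤ d) :
    Nat.card (FramedBrauerMonoid d n) = d ^ n * Nat.doubleFactorial (2 * n - 1) := by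
  have : NeZero d := ⟨by omega⟩
  rw [Nat.card_congr (Equiv.ofBijective _
    ⟨FramedBrauer.rep_idDiag_injective (d := d) (n := n), FramedBrauer.rep_idDiag_surjective⟩)]
  exact FramedBrauer.card_diag n _ (by simp; omega)
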